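/- Let $\mathcal X,\mathcal Y$ be real Hilbert spaces, $f:\mathcal X\to\mathbb R$ convex and continuously differentiable, $A:\mathcal X\to\mathcal Y$ a bounded linear operator, $b\in\mathcal Y$. Put $\mathcal L(x,\lambda)=f(x)+\langle\lambda,Ax-b\rangle$ and, for $t>0$ and constants $c>0$, $p>0$, $$\mathcal L_t(x,\lambda)=\mathcal L(x,\lambda)+\frac{c}{2t^p}\left(\|x\|^2-\|\lambda\|^2\right).$$ Let $\Omega$ be the set of saddle points of $\mathcal L$, i.e. of pairs $(\bar x,\bar\lambda)$ with $\mathcal L(\bar x,\lambda)\le\mathcal L(\bar x,\bar\lambda)\le\mathcal L(x,\bar\lambda)$ for all $(x,\lambda)\in\mathcal X\times\mathcal Y$. Suppose $\Omega\neq\emptyset$ and let $(x^*,\lambda^*)=\mathrm{Proj}_\Omega 0$ be its element of minimal norm, where $\|(x,\lambda)\|^2=\|x\|^2+\|\lambda\|^2$. Let $t_0>0$, $\alpha>1$, $\gamma>0$, $0<q<1$, $s>0$, and let $m:[t_0,+\infty)\to(0,+\infty)$ be differentiable and non-increasing, and twice differentiable for all large $t$. Suppose that there are $k_1,k_2>0$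 such that, for all large $t$, $$\frac{\gamma}{t^{q+s}}\le m(t)\le\frac{k_1}{t^q},\qquad t|\dot m(t)|\le k_2m(t),\qquad t^2|\ddot m(t)|\le k_2m(t).$$ Let $(x,\lambda):[t_0,+\infty)\to\mathcal X\times\mathcal Y$ be a global solution of $$m(t)\ddot x(t)+\frac{\alpha}{t^q}\dot x(t)+\gamma\frac{d}{dt}\nabla_x\mathcal L_t(x(t),\lambda(t))+t^s\nabla_x\mathcal L_t(x(t),\lambda(t))=0,$$ $$\dot\lambda(t)-(\alpha-1)\left(t^{q+s}-\gamma qt^{q-1}\right)\nabla_\lambda\mathcal L_t\left(x(t)+\theta(t)\dot x(t),\lambda(t)\right)=0,$$ where $$\theta(t)=\frac{m(t)t^{2q+s}+\gamma t^q-2m(t)\gamma qt^{2q-1}-\gamma\dot m(t)t^{2q}}{(\alpha-1)(t^{q+s}-\gamma qt^{q-1})};$$ that is, $x$ is twice differentiable, $\lambda$ and $t\mapsto\nabla_x\mathcal L_t(x(t),\lambda(t))$ are differentiable on $[t_0,+\infty)$, and both equations hold for all $t\ge t_0$. Suppose that $0<p<\frac{1-q}{2}$, $5q+2s-1<0$ and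 $4q+s+p-2<0$. Then, for every $t\ge t_0$, $\mathcal L_t$ has a unique saddle point $(x_t,\lambda_t)$, and the following hold. (i) $\lim_{t\to+\infty}\|(x(t),\lambda(t))-(x^*,\lambda^*)\|=0$. (ii) If $p<2q+s$, then, as $t\to+\infty$, each of the quantities $\mathcal L(x(t),\lambda^*)-\mathcal L(x^*,\lambda^*)$, $|f(x(t))-f(x^*)|$ and $\|Ax(t)-b\|$ is $$\mathcal O\left(\sqrt{m(t)}\,t^{\frac{3q+s-p-1}{2}}+\frac1{t^p}\right),$$ and $\|(x(t)-x_t,\lambda(t)-\lambda_t)\|^2=\mathcal O\left(m(t)\,t^{3q+s-p-1}\right)$. (iii) If $2q+s\le p<\frac{1-q}{2}$, then, as $t\to+\infty$, each of the quantities $\mathcal L(x(t),\lambda^*)-\mathcal L(x^*,\lambda^*)$, $|f(x(t))-f(x^*)|$ and $\|Ax(t)-b\|$ is $$\mathcal O\left(\sqrt{m(t)}\,t^{\frac{q-1}{2}}+\frac1{t^p}\right),$$ and $\|(x(t)-x_t,\lambda(t)-\lambda_t)\|^2=\mathcal O\left(m(t)\,t^{q-1}\right)$. -/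

import Mathlib

open Set Filter Topology Asymptotics

noncomputable section

/-- The Lagrangian `𝓛(x, μ) = f(x) + ⟪μ, A x - b⟫` of the problem `min f(x)` s.t. `A x = b`. -/
def lagrangian {X Y : Type*} [NormedAddCommGroup X] [InnerProductSpace ℝ X]
    [NormedAddCommGroup Y] [InnerProductSpace ℝ Y]
    (f : X → ℝ) (A : X →L[ℝ] Y) (b : Y) (x : X) (μ : Y) : ℝ :=
  f x + inner ℝ μ (A x - b)

/-- The augmented (Tikhonov regularized) Lagrangian
`𝓛_t(x, μ) = 𝓛(x, μ) + c / (2 t ^ p) * (‖x‖² - ‖μ‖²)`. -/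
def augLagrangian {X Y : Type*} [NormedAddCommGroup X] [InnerProductSpace ℝ X]
    [NormedAddCommGroup Y] [InnerProductSpace ℝ Y]
    (f : X → ℝ) (A : X →L[ℝ] Y) (b : Y) (c p t : ℝ) (x : X) (μ : Y) : ℝ :=
  lagrangian f A b x μ + c / (2 * t ^ p) * (‖x‖ ^ 2 - ‖μ‖ ^ 2)

/-- The set `Ω` of saddle points of the Lagrangian, in the Hilbert product `X × Y`
(with `‖(x, μ)‖² = ‖x‖² + ‖μ‖²`). -/
def saddleSet {X Y : Type*} [NormedAddCommGroup X] [InnerProductSpace ℝ X]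
    [NormedAddCommGroup Y] [InnerProductSpace ℝ Y]
    (f : X → ℝ) (A : X →L[ℝ] Y) (b : Y) : Set (WithLp 2 (X × Y)) :=
  {z | IsSaddlePointOn univ univ (lagrangian f A b) z.fst z.snd}

/-- `w` is a projection of `z` onto `S`: a point of `S` at least distance from `z`. -/
def IsProjOnto {E : Type*} [NormedAddCommGroup E] (S : Set E) (z w : E) : Prop :=
  w ∈ S ∧ ∀ v ∈ S, ‖z - w‖ ≤ ‖z - v‖

/-- The time derivative of a function on `[t₀, +∞)` (one-sided at `t₀`). -/
def timeDeriv {E : Type*} [NormedAddCommGroup E] [NormedSpace ℝ E]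
    (t₀ : ℝ) (u : ℝ → E) (t : ℝ) : E :=
  derivWithin u (Ici t₀) t

/-- The gradient of `𝓛_t` with respect to its first argument. -/
def gradX {X Y : Type*} [NormedAddCommGroup X] [InnerProductSpace ℝ X] [CompleteSpace X]
    [NormedAddCommGroup Y] [InnerProductSpace ℝ Y]
    (f : X → ℝ) (A : X →L[ℝ] Y) (b : Y) (c p t : ℝ) (x : X) (μ : Y) : X :=
  gradient (fun u : X => augLagrangian f A b c p t u μ) x

/-- The gradient of `𝓛_t` with respect to its second argument. -/
def gradDual {X Y : Type*} [NormedAddCommGroup X] [InnerProductSpace ℝ X]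
    [NormedAddCommGroup Y] [InnerProductSpace ℝ Y] [CompleteSpace Y]
    (f : X → ℝ) (A : X →L[ℝ] Y) (b : Y) (c p t : ℝ) (x : X) (μ : Y) : Y :=
  gradient (fun v : Y => augLagrangian f A b c p t x v) μ

/-- The mass is a positive, differentiable and non-increasing function on `[t₀, +∞)`. -/
structure IsMass (t₀ : ℝ) (m : ℝ → ℝ) : Prop where
  pos : ∀ t ∈ Ici t₀, 0 < m t
  differentiable : DifferentiableOn ℝ m (Ici t₀)
  antitone : AntitoneOn m (Ici t₀)

/-- There is `k₁ > 0` with `γ / t ^ (q + s) ≤ m(t) ≤ k₁ / t ^ q` for all large `t`. -/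
def MassBounds (γ q s : ℝ) (m : ℝ → ℝ) : Prop :=
  ∃ k₁ : ℝ, 0 < k₁ ∧ ∀ᶠ t in atTop, γ / t ^ (q + s) ≤ m t ∧ m t ≤ k₁ / t ^ q

/-- There is `k₂ > 0` such that for all large `t` the second derivative of `m` exists at `t`,
`t |m'(t)| ≤ k₂ m(t)` and `t² |m''(t)| ≤ k₂ m(t)`. -/
def MassDerivBounds (t₀ : ℝ) (m : ℝ → ℝ) : Prop :=
  ∃ k₂ : ℝ, 0 < k₂ ∧ ∀ᶠ t in atTop,
    DifferentiableWithinAt ℝ (timeDeriv t₀ m) (Ici t₀) t ∧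
    t * |timeDeriv t₀ m t| ≤ k₂ * m t ∧
    t ^ 2 * |timeDeriv t₀ (timeDeriv t₀ m) t| ≤ k₂ * m t

/-- The extrapolation parameter `θ(t)`. -/
def extrapolation (α γ q s t₀ : ℝ) (m : ℝ → ℝ) (t : ℝ) : ℝ :=
  (m t * t ^ (2 * q + s) + γ * t ^ q - 2 * m t * γ * q * t ^ (2 * q - 1)
      - γ * timeDeriv t₀ m t * t ^ (2 * q)) /
    ((α - 1) * (t ^ (q + s) - γ * q * t ^ (q - 1)))

/-- `(x, μ)` is a global (classical) solution on `[t₀, +∞)` of the primal-dual system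
`m(t) x'' + (α / t^q) x' + γ d/dt ∇ₓ𝓛_t(x, μ) + t^s ∇ₓ𝓛_t(x, μ) = 0`,
`μ' - (α - 1)(t^(q+s) - γ q t^(q-1)) ∇_μ 𝓛_t(x + θ(t) x', μ) = 0`. -/
structure IsGlobalSolution {X Y : Type*}
    [NormedAddCommGroup X] [InnerProductSpace ℝ X] [CompleteSpace X]
    [NormedAddCommGroup Y] [InnerProductSpace ℝ Y] [CompleteSpace Y]
    (f : X → ℝ) (A : X →L[ℝ] Y) (b : Y) (c p α γ q s t₀ : ℝ) (m : ℝ → ℝ)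
    (x : ℝ → X) (μ : ℝ → Y) : Prop where
  differentiable_x : DifferentiableOn ℝ x (Ici t₀)
  differentiable_velocity : DifferentiableOn ℝ (timeDeriv t₀ x) (Ici t₀)
  differentiable_grad : DifferentiableOn ℝ (fun t => gradX f A b c p t (x t) (μ t)) (Ici t₀)
  differentiable_dual : DifferentiableOn ℝ μ (Ici t₀)
  primal_eq : ∀ t ∈ Ici t₀,
    m t • timeDeriv t₀ (timeDeriv t₀ x) t + (α / t ^ q) • timeDeriv t₀ x t
      + γ • timeDeriv t₀ (fun τ => gradX f A b c p τ (x τ) (μ τ)) t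
      + t ^ s • gradX f A b c p t (x t) (μ t) = 0
  dual_eq : ∀ t ∈ Ici t₀,
    timeDeriv t₀ μ t - ((α - 1) * (t ^ (q + s) - γ * q * t ^ (q - 1))) •
      gradDual f A b c p t (x t + extrapolation α γ q s t₀ m t • timeDeriv t₀ x t) (μ t) = 0

end

/-! Saddle points of `𝓛` are the zeros of the monotone operator T(x, μ) = (∇f(x) + A*μ, b - Ax), and
saddle points of `𝓛_t` are the solutions of T z + ε z = 0 with ε = c / t^p. Hence z_t = (x_t, λ_t)
is the Tikhonov path of T: it is bounded by the norm of z* = (x*, λ*) and converges strongly to z*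
(`IsMonotoneOperator.tendsto_path`). What remains is to show that the trajectory tracks the path at
the stated rate.

Multiplied by t^q, the primal equation becomes a first order law for the momentum V = t^q m x' + γ
t^q ∇ₓ𝓛_t, namely V' = (η - α) x' - δ ∇ₓ𝓛_t with η = (t^q m)' and δ = t^(q+s) - γ q t^(q-1). With κ
= α - 1, take as `energy` the sum of β (𝓛_t(x, λ_t) - 𝓛_t(x_t, λ_t)), ‖κ(x - x_t) + V‖² / 2, κ(1 -
η)‖x - x_t‖² / 2 and ‖λ - λ_t‖² / 2. The weight β that cancels every indefinite cross term is
exactly the factor of A x' produced by the extrapolation in the dual equation (`extrapolation_mul`),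
so that with the reference point frozen only damping terms and a term in ε' survive
(`energy_deriv_le`).

The path need not be differentiable, but monotonicity bounds its displacement by |Δε| ‖z_t‖ / ε, so
its speed is at most ‖z*‖ p / t. This suffices for an upper right Dini derivative
(`eventually_slope_energy_lt`). Young's inequality absorbs the forcing into the damping
(`damping_estimate`), giving D⁺E ≤ -θ t^(-r) E + C t^(-r) (m t^σ). As r < 1, this decay outruns the
O(1/t) logarithmic derivative of m t^σ, and a fencing argument yields E = O(m t^σ)
(`exists_le_mul_of_slope_lt`). The constraints r ≥ max(0, p - q - s), 2q + s + p - 2 ≤ σ - r and q -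
2 ≤ σ - r allow the exponents of (ii) and (iii). The 1 / t^p in the rates is the error of the path
itself. -/

noncomputable section

/-! ### Gradient inequalities and existence of minimizers for uniformly convex functions -/

section ConvexGradient

variable {X : Type*} [NormedAddCommGroup X] [InnerProductSpace ℝ X] [CompleteSpace X]

/-- The gradient inequality for a differentiable convex function. -/
theorem ConvexOn.add_inner_gradient_le {f : X → ℝ} (hf : ConvexOn ℝ univ f)
    (hd : Differentiable ℝ f) (x y : X) : f x + inner ℝ (gradient f x) (y - x) ≤ f y := by
  have hline : HasDerivAt (fun r : ℝ => f (AffineMap.lineMap x y r))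
      (inner ℝ (gradient f x) (y - x)) 0 := by
    have h1 : HasDerivAt (AffineMap.lineMap x y : ℝ → X) (y - x) 0 :=
      AffineMap.hasDerivAt_lineMap
    have h2 : HasFDerivAt f (fderiv ℝ f x) (AffineMap.lineMap x y (0 : ℝ)) := by
      simpa using (hd x).hasFDerivAt
    have h3 := h2.comp_hasDerivAt (0 : ℝ) h1
    rw [inner_gradient_left]
    exact h3
  have hconv : ConvexOn ℝ univ (fun r : ℝ => f (AffineMap.lineMap x y r)) :=
    hf.comp_affineMap (AffineMap.lineMap x y)
  have h := hconv.le_slope_of_hasDerivAt (mem_univ 0) (mem_univ 1) one_pos hline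
  simp only [slope_def_field, AffineMap.lineMap_apply_one, AffineMap.lineMap_apply_zero,
    sub_zero, div_one] at h
  linarith

theorem ConvexOn.inner_gradient_sub_nonneg {f : X → ℝ} (hf : ConvexOn ℝ univ f)
    (hd : Differentiable ℝ f) (x y : X) :
    0 ≤ inner ℝ (gradient f x - gradient f y) (x - y) := by
  have h1 := hf.add_inner_gradient_le hd x y
  have h2 := hf.add_inner_gradient_le hd y x
  rw [inner_sub_left]
  have h3 : inner ℝ (gradient f x) (y - x) = - inner ℝ (gradient f x) (x - y) := by
    rw [← inner_neg_right, neg_sub]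
  linarith

theorem ContDiff.continuous_gradient {f : X → ℝ} (hf : ContDiff ℝ 1 f) :
    Continuous (gradient f) :=
  (InnerProductSpace.toDual ℝ X).symm.continuous.comp (hf.continuous_fderiv one_ne_zero)

/-- A continuous, bounded below, uniformly midpoint convex function attains its minimum. -/
theorem exists_forall_le_of_midpoint {φ : X → ℝ} (hφ : Continuous φ) (hb : BddBelow (range φ))
    {k : ℝ} (hk : 0 < k)
    (hmid : ∀ x y, φ ((1 / 2 : ℝ) • (x + y)) + k * ‖x - y‖ ^ 2 ≤ (φ x + φ y) / 2) :
    ∃ a, ∀ x, φ a ≤ φ x := by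
  set I := sInf (range φ) with hI
  have hle : ∀ x, I ≤ φ x := fun x => csInf_le hb (mem_range_self x)
  have hex : ∀ n : ℕ, ∃ x, φ x < I + 1 / ((n : ℝ) + 1) := by
    intro n
    have hlt : I < I + 1 / ((n : ℝ) + 1) := by
      have : (0 : ℝ) < 1 / ((n : ℝ) + 1) := by positivity
      linarith
    obtain ⟨_, ⟨x, rfl⟩, hx⟩ := exists_lt_of_csInf_lt (range_nonempty φ) hlt
    exact ⟨x, hx⟩
  choose u hu using hex
  -- The midpoint of two near-minimizers cannot lie below the infimum, so near-minimizers are close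
  -- to each other.
  have hdist : ∀ i j, k * ‖u i - u j‖ ^ 2 ≤ (φ (u i) + φ (u j)) / 2 - I := by
    intro i j
    have h1 := hmid (u i) (u j)
    have h2 := hle ((1 / 2 : ℝ) • (u i + u j))
    linarith
  have hcau : CauchySeq u := by
    refine Metric.cauchySeq_iff'.2 fun e he => ?_
    obtain ⟨N, hN⟩ := exists_nat_one_div_lt (show 0 < k * e ^ 2 by positivity)
    refine ⟨N, fun n hn => ?_⟩
    rw [dist_eq_norm]
    have h1 := hdist n N
    have h2 := hu n
    have h3 := hu N
    have h4 : 1 / ((n : ℝ) + 1) ≤ 1 / ((N : ℝ) + 1) := by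
      have : (N : ℝ) ≤ n := by exact_mod_cast hn
      gcongr
    have h5 : k * ‖u n - u N‖ ^ 2 < k * e ^ 2 := by linarith
    exact lt_of_pow_lt_pow_left₀ 2 he.le (lt_of_mul_lt_mul_left h5 hk.le)
  obtain ⟨a, ha⟩ := cauchySeq_tendsto_of_complete hcau
  refine ⟨a, fun x => le_trans ?_ (hle x)⟩
  have h1 : Tendsto (fun n => φ (u n)) atTop (𝓝 (φ a)) := (hφ.tendsto a).comp ha
  have h2 : Tendsto (fun n : ℕ => I + 1 / ((n : ℝ) + 1)) atTop (𝓝 (I + 0)) :=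
    tendsto_const_nhds.add tendsto_one_div_add_atTop_nhds_zero_nat
  rw [add_zero] at h2
  exact le_of_tendsto_of_tendsto' h1 h2 fun n => (hu n).le

end ConvexGradient

/-! ### Saddle points of the regularized Lagrangian and their optimality conditions -/

section Saddle

variable {X Y : Type*} [NormedAddCommGroup X] [InnerProductSpace ℝ X]
  [NormedAddCommGroup Y] [InnerProductSpace ℝ Y]
  {f : X → ℝ} {A : X →L[ℝ] Y} {b : Y}

/-- The Lagrangian with regularization `ε / 2 * (‖x‖² - ‖μ‖²)`. -/
def regLagrangian (f : X → ℝ) (A : X →L[ℝ] Y) (b : Y) (ε : ℝ) (x : X) (μ : Y) : ℝ :=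
  lagrangian f A b x μ + ε / 2 * (‖x‖ ^ 2 - ‖μ‖ ^ 2)

theorem augLagrangian_eq_regLagrangian (f : X → ℝ) (A : X →L[ℝ] Y) (b : Y) (c p t : ℝ) :
    augLagrangian f A b c p t = regLagrangian f A b (c / t ^ p) := by
  funext x μ
  unfold augLagrangian regLagrangian
  rw [div_div, mul_comm 2 (t ^ p)]

theorem lagrangian_eq_regLagrangian (f : X → ℝ) (A : X →L[ℝ] Y) (b : Y) :
    lagrangian f A b = regLagrangian f A b 0 := by
  funext x μ
  simp [regLagrangian]

variable [CompleteSpace X] [CompleteSpace Y]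

/-- First order optimality conditions for a saddle point of the regularized Lagrangian. -/
def IsCritical (f : X → ℝ) (A : X →L[ℝ] Y) (b : Y) (ε : ℝ) (x : X) (μ : Y) : Prop :=
  gradient f x + A.adjoint μ + ε • x = 0 ∧ A x - b = ε • μ

theorem hasGradientAt_regLagrangian_fst (hd : Differentiable ℝ f) (ε : ℝ) (x : X) (μ : Y) :
    HasGradientAt (fun u => regLagrangian f A b ε u μ)
      (gradient f x + A.adjoint μ + ε • x) x := by
  rw [hasGradientAt_iff_hasFDerivAt]
  have h1 : HasFDerivAt f (fderiv ℝ f x) x := (hd x).hasFDerivAt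
  have h2 : HasFDerivAt (fun u : X => inner ℝ μ (A u - b)) ((innerSL ℝ μ).comp A) x :=
    ((innerSL ℝ μ).hasFDerivAt.comp x (A.hasFDerivAt.sub_const b))
  have h3 : HasFDerivAt (fun u : X => ‖u‖ ^ 2) (2 • innerSL ℝ x) x :=
    (hasStrictFDerivAt_norm_sq x).hasFDerivAt
  have h4 := (h1.add h2).add ((h3.sub_const (‖μ‖ ^ 2)).const_mul (ε / 2))
  refine h4.congr_fderiv ?_
  ext v
  simp [ContinuousLinearMap.adjoint_inner_left]
  ring

omit [CompleteSpace X] in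
theorem hasGradientAt_regLagrangian_snd (ε : ℝ) (x : X) (μ : Y) :
    HasGradientAt (fun v => regLagrangian f A b ε x v) (A x - b - ε • μ) μ := by
  rw [hasGradientAt_iff_hasFDerivAt]
  have h2 : HasFDerivAt (fun v : Y => inner ℝ v (A x - b)) (innerSL ℝ (A x - b)) μ := by
    have := (innerSL ℝ (A x - b)).hasFDerivAt (x := μ)
    refine this.congr_of_eventuallyEq (Eventually.of_forall fun v => ?_)
    exact real_inner_comm _ _
  have h3 : HasFDerivAt (fun u : Y => ‖u‖ ^ 2) (2 • innerSL ℝ μ) μ :=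
    (hasStrictFDerivAt_norm_sq μ).hasFDerivAt
  have h4 := (h2.const_add (f x)).add ((h3.const_sub (‖x‖ ^ 2)).const_mul (ε / 2))
  refine h4.congr_fderiv ?_
  ext v
  simp
  ring

/-- Strong saddle inequality at a critical point. -/
theorem IsCritical.add_le (hf : ConvexOn ℝ univ f) (hd : Differentiable ℝ f) {ε : ℝ}
    {a : X} {l : Y} (h : IsCritical f A b ε a l) (x : X) (y : Y) :
    regLagrangian f A b ε a y + ε / 2 * (‖x - a‖ ^ 2 + ‖y - l‖ ^ 2)
      ≤ regLagrangian f A b ε x l := by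
  obtain ⟨h1, h2⟩ := h
  have h3 := hf.add_inner_gradient_le hd a x
  have h4 : gradient f a = - A.adjoint l - ε • a := by
    rw [← sub_eq_zero, ← h1]; abel
  have h5 : A x - b = A (x - a) + ε • l := by rw [← h2, map_sub]; abel
  unfold regLagrangian lagrangian
  rw [h2, h5]
  rw [h4, inner_sub_left, inner_neg_left, ContinuousLinearMap.adjoint_inner_left,
    inner_smul_left, inner_sub_right a, real_inner_self_eq_norm_sq] at h3
  simp only [inner_add_right, inner_smul_right, norm_sub_sq_real, real_inner_self_eq_norm_sq]
  rw [real_inner_comm x a] at h3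
  simp only [conj_trivial] at h3
  nlinarith [h3]

theorem IsCritical.isSaddlePointOn (hf : ConvexOn ℝ univ f) (hd : Differentiable ℝ f) {ε : ℝ}
    (hε : 0 ≤ ε) {a : X} {l : Y} (h : IsCritical f A b ε a l) :
    IsSaddlePointOn univ univ (regLagrangian f A b ε) a l := by
  intro x _ y _
  have h1 := h.add_le hf hd x y
  have h2 : 0 ≤ ε / 2 * (‖x - a‖ ^ 2 + ‖y - l‖ ^ 2) := by positivity
  linarith

theorem IsSaddlePointOn.isCritical (hd : Differentiable ℝ f) {ε : ℝ} {a : X} {l : Y}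
    (h : IsSaddlePointOn univ univ (regLagrangian f A b ε) a l) : IsCritical f A b ε a l := by
  constructor
  · have hmin : IsLocalMin (fun u => regLagrangian f A b ε u l) a :=
      Eventually.of_forall fun u => h u (mem_univ _) l (mem_univ _)
    have h1 := hmin.hasFDerivAt_eq_zero
      (hasGradientAt_iff_hasFDerivAt.1 (hasGradientAt_regLagrangian_fst hd ε a l))
    rwa [LinearIsometryEquiv.map_eq_zero_iff] at h1
  · have hmax : IsLocalMax (fun v => regLagrangian f A b ε a v) l :=
      Eventually.of_forall fun v => h a (mem_univ _) v (mem_univ _)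
    have h1 := hmax.hasFDerivAt_eq_zero
      (hasGradientAt_iff_hasFDerivAt.1 (hasGradientAt_regLagrangian_snd (f := f) ε a l))
    rw [LinearIsometryEquiv.map_eq_zero_iff] at h1
    exact sub_eq_zero.1 h1

/-- Maximizing the regularized Lagrangian over the dual variable gives φ(x) = f(x) + ε/2 ‖x‖² + ‖Ax
- b‖² / (2ε), attained at μ = (Ax - b) / ε. A minimizer of φ paired with this μ is critical. -/
theorem exists_isCritical (hf : ConvexOn ℝ univ f) (hd : Differentiable ℝ f) {ε : ℝ}
    (hε : 0 < ε) : ∃ a l, IsCritical f A b ε a l := by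
  set φ : X → ℝ := fun x => f x + ε / 2 * ‖x‖ ^ 2 + 1 / (2 * ε) * ‖A x - b‖ ^ 2 with hφ
  have hcont : Continuous φ := by
    have := hd.continuous
    fun_prop
  have hbdd : BddBelow (range φ) := by
    refine ⟨f 0 - ‖gradient f 0‖ ^ 2 / (2 * ε), ?_⟩
    rintro _ ⟨x, rfl⟩
    have h1 := hf.add_inner_gradient_le hd 0 x
    rw [sub_zero] at h1
    have h2 := neg_le_of_abs_le (abs_real_inner_le_norm (gradient f 0) x)
    have h3 : 0 ≤ 1 / (2 * ε) * ‖A x - b‖ ^ 2 := by positivity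
    have h4 : 0 ≤ (ε * ‖x‖ - ‖gradient f 0‖) ^ 2 / (2 * ε) := by positivity
    have h5 : (ε * ‖x‖ - ‖gradient f 0‖) ^ 2 / (2 * ε)
        = ε / 2 * ‖x‖ ^ 2 - ‖gradient f 0‖ * ‖x‖ + ‖gradient f 0‖ ^ 2 / (2 * ε) := by
      field_simp
      ring
    simp only [hφ]
    linarith
  -- The gain ε / 8 is the parallelogram identity applied to ε/2 ‖x‖²; the other two terms are
  -- merely midpoint convex.
  have hmid : ∀ x y, φ ((1 / 2 : ℝ) • (x + y)) + ε / 8 * ‖x - y‖ ^ 2 ≤ (φ x + φ y) / 2 := by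
    intro x y
    have h1 : f ((1 / 2 : ℝ) • (x + y)) ≤ (f x + f y) / 2 := by
      have := hf.2 (mem_univ x) (mem_univ y) (show (0 : ℝ) ≤ 1 / 2 by norm_num)
        (show (0 : ℝ) ≤ 1 / 2 by norm_num) (by norm_num)
      rw [← smul_add] at this
      simp only [smul_eq_mul] at this
      linarith
    have h2 : ‖(1 / 2 : ℝ) • (x + y)‖ ^ 2 = (‖x‖ ^ 2 + ‖y‖ ^ 2) / 2 - ‖x - y‖ ^ 2 / 4 := by
      rw [norm_smul, mul_pow, norm_add_sq_real, norm_sub_sq_real]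
      norm_num
      ring
    have h3 : ‖A ((1 / 2 : ℝ) • (x + y)) - b‖ ^ 2 ≤ (‖A x - b‖ ^ 2 + ‖A y - b‖ ^ 2) / 2 := by
      have e : A ((1 / 2 : ℝ) • (x + y)) - b = (1 / 2 : ℝ) • ((A x - b) + (A y - b)) := by
        rw [map_smul, map_add]
        module
      rw [e, norm_smul, mul_pow]
      have := parallelogram_law_with_norm ℝ (A x - b) (A y - b)
      norm_num
      nlinarith [sq_nonneg ‖A x - b - (A y - b)‖]
    simp only [hφ]
    rw [h2]
    have h4 : 1 / (2 * ε) * ‖A ((1 / 2 : ℝ) • (x + y)) - b‖ ^ 2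
        ≤ 1 / (2 * ε) * ((‖A x - b‖ ^ 2 + ‖A y - b‖ ^ 2) / 2) := by gcongr
    linarith
  obtain ⟨a, ha⟩ := exists_forall_le_of_midpoint hcont hbdd (show 0 < ε / 8 by positivity) hmid
  refine ⟨a, (1 / ε) • (A a - b), ?_, ?_⟩
  · have hmin : IsLocalMin φ a := Eventually.of_forall ha
    have h1 : HasFDerivAt f (fderiv ℝ f a) a := (hd a).hasFDerivAt
    have h2 : HasFDerivAt (fun u : X => ‖u‖ ^ 2) (2 • innerSL ℝ a) a :=
      (hasStrictFDerivAt_norm_sq a).hasFDerivAt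
    have h3 : HasFDerivAt (fun u : X => ‖A u - b‖ ^ 2) ((2 • innerSL ℝ (A a - b)).comp A) a :=
      (hasStrictFDerivAt_norm_sq (A a - b)).hasFDerivAt.comp (g := fun w : Y => ‖w‖ ^ 2) a
        (A.hasFDerivAt.sub_const b)
    have h4 := hmin.hasFDerivAt_eq_zero
      ((h1.add (h2.const_mul (ε / 2))).add (h3.const_mul (1 / (2 * ε))))
    refine ext_inner_right ℝ fun v => ?_
    have h5 := congrArg (fun L : X →L[ℝ] ℝ => L v) h4
    simp at h5
    simp [inner_add_left, inner_smul_left, inner_gradient_left]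
    rw [inner_sub_left, ContinuousLinearMap.adjoint_inner_left,
      ContinuousLinearMap.adjoint_inner_left]
    linear_combination h5
  · rw [smul_smul, mul_one_div_cancel hε.ne', one_smul]

end Saddle

/-! ### The Tikhonov path of a monotone operator -/

section TikhonovPath

variable {H : Type*} [NormedAddCommGroup H] [InnerProductSpace ℝ H] {T : H → H}

/-- Monotonicity of an operator on a Hilbert space. -/
def IsMonotoneOperator (T : H → H) : Prop := ∀ x y, 0 ≤ inner ℝ (T x - T y) (x - y)

theorem IsMonotoneOperator.inner_le (hT : IsMonotoneOperator T) {z w : H} {ε : ℝ} (hε : 0 < ε)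
    (hz : T z + ε • z = 0) (hw : T w = 0) : ‖z‖ ^ 2 ≤ inner ℝ z w := by
  have h := hT z w
  rw [hw, sub_zero, eq_neg_of_add_eq_zero_left hz, inner_neg_left, real_inner_smul_left,
    inner_sub_right, real_inner_self_eq_norm_sq] at h
  nlinarith

theorem IsMonotoneOperator.norm_le (hT : IsMonotoneOperator T) {z w : H} {ε : ℝ} (hε : 0 < ε)
    (hz : T z + ε • z = 0) (hw : T w = 0) : ‖z‖ ≤ ‖w‖ := by
  have h1 := hT.inner_le hε hz hw
  have h2 := real_inner_le_norm z w
  by_contra! h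
  nlinarith [norm_nonneg z, norm_nonneg w]

/-- Both resolvent equations turn T z₁ - T z₂ into (ε₂ - ε₁) z₁ - ε₂ (z₁ - z₂), to which
monotonicity applies. Lipschitz dependence on ε and the growth of the norm along the path both
follow from it. -/
theorem IsMonotoneOperator.mul_norm_sub_sq_le (hT : IsMonotoneOperator T) {z₁ z₂ : H}
    {ε₁ ε₂ : ℝ} (h₁ : T z₁ + ε₁ • z₁ = 0) (h₂ : T z₂ + ε₂ • z₂ = 0) :
    ε₂ * ‖z₁ - z₂‖ ^ 2 ≤ (ε₂ - ε₁) * inner ℝ z₁ (z₁ - z₂) := by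
  have h := hT z₁ z₂
  have e : T z₁ - T z₂ = (ε₂ - ε₁) • z₁ - ε₂ • (z₁ - z₂) := by
    rw [eq_neg_of_add_eq_zero_left h₁, eq_neg_of_add_eq_zero_left h₂]
    module
  rw [e, inner_sub_left, real_inner_smul_left, real_inner_smul_left,
    real_inner_self_eq_norm_sq] at h
  linarith

/-- Substitutes for differentiability of the path: the displacement is controlled by the change of
ε. With ε₁ = ε₂ it gives uniqueness. -/
theorem IsMonotoneOperator.mul_norm_sub_le (hT : IsMonotoneOperator T) {z₁ z₂ : H} {ε₁ ε₂ : ℝ}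
    (h₁ : T z₁ + ε₁ • z₁ = 0) (h₂ : T z₂ + ε₂ • z₂ = 0) :
    ε₂ * ‖z₁ - z₂‖ ≤ |ε₂ - ε₁| * ‖z₁‖ := by
  rcases (norm_nonneg (z₁ - z₂)).eq_or_lt with h0 | h0
  · rw [← h0]
    simp only [mul_zero]
    positivity
  have h := hT.mul_norm_sub_sq_le h₁ h₂
  have h3 : (ε₂ - ε₁) * inner ℝ z₁ (z₁ - z₂) ≤ |ε₂ - ε₁| * (‖z₁‖ * ‖z₁ - z₂‖) :=
    calc _ ≤ |(ε₂ - ε₁) * inner ℝ z₁ (z₁ - z₂)| := le_abs_self _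
      _ = |ε₂ - ε₁| * |inner ℝ z₁ (z₁ - z₂)| := abs_mul _ _
      _ ≤ _ := by gcongr; exact abs_real_inner_le_norm _ _
  refine le_of_mul_le_mul_right ?_ h0
  linarith

/-- As ε decreases, `mul_norm_sub_sq_le` forces ⟨z₁, z₂ - z₁⟩ ≥ 0. Thus the squared norm increases
by at least the squared displacement, which makes a bounded path Cauchy. -/
theorem IsMonotoneOperator.norm_sub_sq_le (hT : IsMonotoneOperator T) {z₁ z₂ : H} {ε₁ ε₂ : ℝ}
    (hε : 0 < ε₂) (hle : ε₂ ≤ ε₁) (h₁ : T z₁ + ε₁ • z₁ = 0) (h₂ : T z₂ + ε₂ • z₂ = 0) :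
    ‖z₂ - z₁‖ ^ 2 ≤ ‖z₂‖ ^ 2 - ‖z₁‖ ^ 2 := by
  have h := hT.mul_norm_sub_sq_le h₁ h₂
  have hin : 0 ≤ inner ℝ z₁ (z₂ - z₁) := by
    rcases hle.eq_or_lt with he | hlt
    · have h0 : ‖z₁ - z₂‖ ^ 2 ≤ 0 := by
        rw [he, sub_self, zero_mul, ← he] at h
        nlinarith
      have h1 : z₁ - z₂ = 0 := by
        rw [← norm_eq_zero]
        nlinarith [norm_nonneg (z₁ - z₂)]
      rw [← neg_sub, h1]
      simp
    · have h1 : 0 ≤ ε₂ * ‖z₁ - z₂‖ ^ 2 := by positivity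
      have h2 : inner ℝ z₁ (z₂ - z₁) = - inner ℝ z₁ (z₁ - z₂) := by
        rw [← inner_neg_right, neg_sub]
      nlinarith
  have e : ‖z₂‖ ^ 2 = ‖z₁‖ ^ 2 + 2 * inner ℝ z₁ (z₂ - z₁) + ‖z₂ - z₁‖ ^ 2 := by
    rw [← norm_add_sq_real, add_sub_cancel]
  linarith

/-- Convergence of the Tikhonov path to the zero of minimal norm. -/
theorem IsMonotoneOperator.tendsto_path [CompleteSpace H] (hT : IsMonotoneOperator T)
    (hc : Continuous T) {w : H} (hw : T w = 0) (hmin : ∀ v, T v = 0 → ‖w‖ ≤ ‖v‖)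
    {t₀ : ℝ} {ε : ℝ → ℝ} {z : ℝ → H} (hε : ∀ t ≥ t₀, 0 < ε t) (hanti : AntitoneOn ε (Ici t₀))
    (hε0 : Tendsto ε atTop (𝓝 0)) (hz : ∀ t ≥ t₀, T (z t) + ε t • z t = 0) :
    Tendsto z atTop (𝓝 w) := by
  -- Freezing the path to the left of t₀ makes its squared norm monotone on the whole line.
  set y : ℝ → H := fun t => z (max t t₀) with hy
  have hsq : ∀ s t, s ≤ t → ‖y t - y s‖ ^ 2 ≤ ‖y t‖ ^ 2 - ‖y s‖ ^ 2 := fun s t hst =>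
    hT.norm_sub_sq_le (hε _ (le_max_right _ _))
      (hanti (le_max_right s t₀) (le_max_right t t₀) (max_le_max_right t₀ hst))
      (hz _ (le_max_right _ _)) (hz _ (le_max_right _ _))
  have hmono : Monotone fun t => ‖y t‖ ^ 2 := by
    intro s t hst
    have h1 := hsq s t hst
    have h2 := sq_nonneg ‖y t - y s‖
    simp only
    linarith
  have hle : ∀ t, ‖y t‖ ≤ ‖w‖ := fun t =>
    hT.norm_le (hε _ (le_max_right t t₀)) (hz _ (le_max_right t t₀)) hw
  have hbdd : BddAbove (range fun t => ‖y t‖ ^ 2) := by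
    refine ⟨‖w‖ ^ 2, ?_⟩
    rintro _ ⟨t, rfl⟩
    exact pow_le_pow_left₀ (norm_nonneg _) (hle t) 2
  have hlim := tendsto_atTop_ciSup hmono hbdd
  set L := ⨆ t, ‖y t‖ ^ 2
  have hcau : CauchySeq y := by
    refine Metric.cauchySeq_iff'.2 fun e he => ?_
    have h1 : ∀ᶠ t in atTop, L - e ^ 2 < ‖y t‖ ^ 2 :=
      hlim.eventually (lt_mem_nhds (by have : 0 < e ^ 2 := by positivity
                                       linarith))
    obtain ⟨N, hN⟩ := h1.exists
    refine ⟨N, fun n hn => ?_⟩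
    rw [dist_eq_norm]
    have h2 := hsq N n hn
    have h3 : ‖y n‖ ^ 2 ≤ L := le_ciSup hbdd n
    exact lt_of_pow_lt_pow_left₀ 2 he.le (by linarith)
  obtain ⟨v, hv⟩ := cauchySeq_tendsto_of_complete hcau
  have hyz : y =ᶠ[atTop] z := by
    filter_upwards [eventually_ge_atTop t₀] with t ht
    simp only [hy, max_eq_left ht]
  have hzv : Tendsto z atTop (𝓝 v) := hv.congr' hyz
  have hTv : T v = 0 := by
    have h1 : Tendsto (fun t => T (z t) + ε t • z t) atTop (𝓝 (T v + (0 : ℝ) • v)) :=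
      ((hc.tendsto v).comp hzv).add (hε0.smul hzv)
    rw [zero_smul, add_zero] at h1
    refine tendsto_nhds_unique h1 (tendsto_const_nhds.congr' ?_)
    filter_upwards [eventually_ge_atTop t₀] with t ht
    exact (hz t ht).symm
  -- This survives in the limit and gives ‖w - v‖² ≤ ‖w‖² - ‖v‖², which is nonpositive because w has
  -- minimal norm among the zeros.
  have hin : ‖v‖ ^ 2 ≤ inner ℝ v w := by
    refine le_of_tendsto_of_tendsto ((hzv.norm).pow 2) (hzv.inner tendsto_const_nhds) ?_
    filter_upwards [eventually_ge_atTop t₀] with t ht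
    exact hT.inner_le (hε t ht) (hz t ht) hw
  have hvw : w = v := by
    have h1 := hmin v hTv
    have h2 : ‖w - v‖ ^ 2 ≤ 0 := by
      rw [norm_sub_sq_real, real_inner_comm]
      nlinarith [norm_nonneg w, norm_nonneg v]
    rw [← sub_eq_zero, ← norm_eq_zero]
    nlinarith [norm_nonneg (w - v)]
  rw [hvw]
  exact hzv

end TikhonovPath

/-! ### Saddle points as zeros of a monotone operator -/

section SaddleOperator

variable {X Y : Type*} [NormedAddCommGroup X] [InnerProductSpace ℝ X]
  [NormedAddCommGroup Y] [InnerProductSpace ℝ Y] [CompleteSpace X] [CompleteSpace Y]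
  {f : X → ℝ} {A : X →L[ℝ] Y} {b : Y}

/-- The monotone operator whose zeros are the saddle points of the Lagrangian. -/
def saddleOperator (f : X → ℝ) (A : X →L[ℝ] Y) (b : Y) (z : WithLp 2 (X × Y)) :
    WithLp 2 (X × Y) :=
  WithLp.toLp 2 (gradient f z.fst + A.adjoint z.snd, b - A z.fst)

/-- The part built from A and its adjoint is skew and drops out of the inner product; only the
monotonicity of ∇f is left. -/
theorem isMonotoneOperator_saddleOperator (hf : ConvexOn ℝ univ f) (hd : Differentiable ℝ f) :
    IsMonotoneOperator (saddleOperator f A b) := by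
  intro z w
  have h := hf.inner_gradient_sub_nonneg hd z.fst w.fst
  have e : inner ℝ (saddleOperator f A b z - saddleOperator f A b w) (z - w)
      = inner ℝ (gradient f z.fst - gradient f w.fst) (z.fst - w.fst) := by
    rw [WithLp.prod_inner_apply]
    simp only [saddleOperator, WithLp.ofLp_sub, Prod.fst_sub, Prod.snd_sub, WithLp.ofLp_fst,
      WithLp.ofLp_snd]
    have h1 : gradient f z.fst + A.adjoint z.snd - (gradient f w.fst + A.adjoint w.snd)
        = (gradient f z.fst - gradient f w.fst) + A.adjoint (z.snd - w.snd) := by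
      rw [map_sub]; abel
    have h2 : b - A z.fst - (b - A w.fst) = - A (z.fst - w.fst) := by rw [map_sub]; abel
    rw [h1, h2, inner_add_left, ContinuousLinearMap.adjoint_inner_left, inner_neg_left,
      real_inner_comm (A (z.fst - w.fst))]
    ring
  rw [e]
  exact h

theorem continuous_saddleOperator (hf : ContDiff ℝ 1 f) :
    Continuous (saddleOperator f A b) := by
  have h1 := hf.continuous_gradient
  unfold saddleOperator
  have h2 : Continuous fun z : WithLp 2 (X × Y) => z.fst := WithLp.continuous_fst 2 X Y
  have h3 : Continuous fun z : WithLp 2 (X × Y) => z.snd := WithLp.continuous_snd 2 X Y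
  fun_prop

theorem saddleOperator_add_smul_eq_zero_iff {ε : ℝ} {z : WithLp 2 (X × Y)} :
    saddleOperator f A b z + ε • z = 0 ↔ IsCritical f A b ε z.fst z.snd := by
  rw [WithLp.ext_iff, Prod.ext_iff]
  simp only [saddleOperator, IsCritical, WithLp.ofLp_add, WithLp.ofLp_smul, Prod.fst_add,
    Prod.snd_add, Prod.smul_fst, Prod.smul_snd, WithLp.ofLp_zero, Prod.fst_zero, Prod.snd_zero,
    WithLp.ofLp_fst, WithLp.ofLp_snd]
  refine and_congr Iff.rfl ?_
  constructor
  · intro h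
    rw [← sub_eq_zero, ← neg_eq_zero, ← h]
    abel
  · intro h
    rw [← h]
    abel

theorem saddleOperator_eq_zero_iff {z : WithLp 2 (X × Y)} :
    saddleOperator f A b z = 0 ↔ IsCritical f A b 0 z.fst z.snd := by
  rw [← saddleOperator_add_smul_eq_zero_iff, zero_smul, add_zero]

theorem isSaddlePointOn_regLagrangian_iff (hf : ConvexOn ℝ univ f) (hd : Differentiable ℝ f)
    {ε : ℝ} (hε : 0 ≤ ε) {a : X} {l : Y} :
    IsSaddlePointOn univ univ (regLagrangian f A b ε) a l ↔ IsCritical f A b ε a l :=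
  ⟨fun h => h.isCritical hd, fun h => h.isSaddlePointOn hf hd hε⟩

theorem IsCritical.unique (hf : ConvexOn ℝ univ f) (hd : Differentiable ℝ f) {ε : ℝ}
    (hε : 0 < ε) {a a' : X} {l l' : Y} (h : IsCritical f A b ε a l)
    (h' : IsCritical f A b ε a' l') : a = a' ∧ l = l' := by
  have h1 := (isMonotoneOperator_saddleOperator (A := A) (b := b) hf hd).mul_norm_sub_le
    (z₁ := WithLp.toLp 2 (a, l)) (z₂ := WithLp.toLp 2 (a', l'))
    (saddleOperator_add_smul_eq_zero_iff.2 h) (saddleOperator_add_smul_eq_zero_iff.2 h')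
  rw [sub_self, abs_zero, zero_mul] at h1
  have h2 : ‖WithLp.toLp 2 (a, l) - WithLp.toLp 2 (a', l')‖ = 0 := by
    nlinarith [norm_nonneg (WithLp.toLp 2 (a, l) - WithLp.toLp 2 (a', l'))]
  have h3 := sub_eq_zero.1 (norm_eq_zero.1 h2)
  simpa using h3

theorem existsUnique_isSaddlePointOn (hf : ConvexOn ℝ univ f) (hd : Differentiable ℝ f) {ε : ℝ}
    (hε : 0 < ε) : ∃! z : X × Y, IsSaddlePointOn univ univ (regLagrangian f A b ε) z.1 z.2 := by
  obtain ⟨a, l, h⟩ := exists_isCritical (A := A) (b := b) hf hd hε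
  refine ⟨(a, l), (isSaddlePointOn_regLagrangian_iff hf hd hε.le).2 h, ?_⟩
  rintro ⟨a', l'⟩ h'
  have := ((isSaddlePointOn_regLagrangian_iff hf hd hε.le).1 h').unique hf hd hε h
  exact Prod.ext this.1 this.2

end SaddleOperator

/-! ### The Lyapunov energy, its derivative, and the motion of its reference point -/

section Energy

variable {X Y : Type*} [NormedAddCommGroup X] [InnerProductSpace ℝ X]
  [NormedAddCommGroup Y] [InnerProductSpace ℝ Y]
  {f : X → ℝ} {A : X →L[ℝ] Y} {b : Y}

/-- The difference `𝓛_ε(x, l) - 𝓛_ε(a, l)`. -/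
def primalGap (f : X → ℝ) (A : X →L[ℝ] Y) (ε : ℝ) (x a : X) (l : Y) : ℝ :=
  f x - f a + inner ℝ l (A (x - a)) + ε / 2 * (‖x‖ ^ 2 - ‖a‖ ^ 2)

/-- The Lyapunov energy of the state `(x, V, lam)` relative to the reference point `(a, l)`. -/
def energy (f : X → ℝ) (A : X →L[ℝ] Y) (κ β η ε : ℝ) (x V : X) (lam : Y) (a : X) (l : Y) : ℝ :=
  β * primalGap f A ε x a l + 1 / 2 * ‖κ • (x - a) + V‖ ^ 2
    + κ * (1 - η) / 2 * ‖x - a‖ ^ 2 + 1 / 2 * ‖lam - l‖ ^ 2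

variable [CompleteSpace X] [CompleteSpace Y]

theorem IsCritical.primalGap_ge (hf : ConvexOn ℝ univ f) (hd : Differentiable ℝ f) {ε : ℝ}
    {a : X} {l : Y} (h : IsCritical f A b ε a l) (x : X) :
    ε / 2 * ‖x - a‖ ^ 2 ≤ primalGap f A ε x a l := by
  have h1 := h.add_le hf hd x l
  simp only [regLagrangian, lagrangian, sub_self, norm_zero] at h1
  unfold primalGap
  rw [map_sub, inner_sub_right]
  simp only [inner_sub_right] at h1
  linarith

/-- Convexity of f together with the exact expansion of the quadratic term, hence the extra ε/2 ‖x -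
a‖². It converts the product of the gradient with x - a into damping of the gap; no optimality of
(a, l) is needed. -/
theorem primalGap_add_le (hf : ConvexOn ℝ univ f) (hd : Differentiable ℝ f) (ε : ℝ) (x a : X)
    (lam l : Y) :
    primalGap f A ε x a l + ε / 2 * ‖x - a‖ ^ 2 + inner ℝ (lam - l) (A (x - a))
      ≤ inner ℝ (gradient f x + A.adjoint lam + ε • x) (x - a) := by
  have h1 := hf.add_inner_gradient_le hd x a
  have h2 : inner ℝ (gradient f x) (a - x) = - inner ℝ (gradient f x) (x - a) := by
    rw [← inner_neg_right, neg_sub]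
  have h3 : ‖a‖ ^ 2 = ‖x‖ ^ 2 - 2 * inner ℝ x (x - a) + ‖x - a‖ ^ 2 := by
    rw [← norm_sub_sq_real, sub_sub_cancel]
  unfold primalGap
  rw [inner_add_left, inner_add_left, ContinuousLinearMap.adjoint_inner_left,
    real_inner_smul_left, inner_sub_left]
  rw [h3]
  linarith

theorem hasDerivAt_energy (hd : Differentiable ℝ f) {κ : ℝ} {β η ε : ℝ → ℝ} {x V : ℝ → X}
    {lam : ℝ → Y} {t β' η' ε' : ℝ} {w V' : X} {lam' : Y} (hβ : HasDerivAt β β' t)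
    (hη : HasDerivAt η η' t) (hε : HasDerivAt ε ε' t) (hx : HasDerivAt x w t)
    (hV : HasDerivAt V V' t) (hlam : HasDerivAt lam lam' t) (a : X) (l : Y) :
    HasDerivAt (fun s => energy f A κ (β s) (η s) (ε s) (x s) (V s) (lam s) a l)
      (β' * primalGap f A (ε t) (x t) a l
        + β t * (inner ℝ (gradient f (x t) + A.adjoint l + ε t • x t) w
          + ε' / 2 * (‖x t‖ ^ 2 - ‖a‖ ^ 2))
        + inner ℝ (κ • (x t - a) + V t) (κ • w + V')
        + (κ * (1 - η t) * inner ℝ (x t - a) w - κ * η' / 2 * ‖x t - a‖ ^ 2)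
        + inner ℝ (lam t - l) lam') t := by
  have h1 : HasDerivAt (fun s => f (x s)) (inner ℝ (gradient f (x t)) w) t := by
    rw [inner_gradient_left]
    exact (hd (x t)).hasFDerivAt.comp_hasDerivAt t hx
  have h2 : HasDerivAt (fun s => inner ℝ l (A (x s - a))) (inner ℝ l (A w)) t := by
    have := ((innerSL ℝ l).comp A).hasFDerivAt.comp_hasDerivAt t (hx.sub_const a)
    exact this
  have h3 : HasDerivAt (fun s => primalGap f A (ε s) (x s) a l)
      (inner ℝ (gradient f (x t)) w + inner ℝ l (A w)
        + (ε' / 2 * (‖x t‖ ^ 2 - ‖a‖ ^ 2) + ε t / 2 * (2 * inner ℝ (x t) w))) t :=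
    ((h1.sub_const (f a)).add h2).add ((hε.div_const 2).mul (hx.norm_sq.sub_const (‖a‖ ^ 2)))
  have h4 := ((hx.sub_const a).const_smul κ).add hV
  have h5 := (hη.const_sub 1).const_mul κ
  have h6 := (((hβ.mul h3).add (h4.norm_sq.const_mul (1 / 2))).add
    ((h5.div_const 2).mul (hx.sub_const a).norm_sq)).add
    ((hlam.sub_const l).norm_sq.const_mul (1 / 2))
  refine h6.congr_deriv ?_
  simp only [inner_add_left (gradient f (x t) + A.adjoint l), inner_add_left (gradient f (x t)),
    ContinuousLinearMap.adjoint_inner_left, real_inner_smul_left (x t), Pi.add_apply,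
    Pi.smul_apply]
  ring

/-- Along the flow, the frozen energy derivative is bounded by the damping terms. -/
theorem energy_deriv_le (hf : ConvexOn ℝ univ f) (hd : Differentiable ℝ f)
    {κ β β' η η' ε ε' δ ρ ν : ℝ} {x w g V V' a : X} {lam lam' l : Y}
    (hcrit : IsCritical f A b ε a l) (hκδ : 0 ≤ κ * δ)
    (hβ : β = δ * ρ + (1 - η) * ν) (hg : g = gradient f x + A.adjoint lam + ε • x)
    (hV : V = ρ • w + ν • g) (hV' : V' = (η - 1 - κ) • w - δ • g)
    (hlam' : lam' = (κ * δ) • (A x - b - ε • lam) + β • A w) :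
    β' * primalGap f A ε x a l
        + β * (inner ℝ (gradient f x + A.adjoint l + ε • x) w
          + ε' / 2 * (‖x‖ ^ 2 - ‖a‖ ^ 2))
        + inner ℝ (κ • (x - a) + V) (κ • w + V')
        + (κ * (1 - η) * inner ℝ (x - a) w - κ * η' / 2 * ‖x - a‖ ^ 2)
        + inner ℝ (lam - l) lam'
      ≤ (β' - κ * δ) * primalGap f A ε x a l
        - κ * δ * (ε / 2 * ‖x - a‖ ^ 2 + ε * ‖lam - l‖ ^ 2)
        - (1 - η) * ρ * ‖w‖ ^ 2 - ν * δ * ‖g‖ ^ 2 - κ * η' / 2 * ‖x - a‖ ^ 2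
        + β * (ε' / 2 * (‖x‖ ^ 2 - ‖a‖ ^ 2)) := by
  have h1 := primalGap_add_le (A := A) hf hd ε x a lam l
  rw [← hg] at h1
  have h2 : gradient f x + A.adjoint l + ε • x = g - A.adjoint (lam - l) := by
    rw [hg, map_sub]; abel
  have h3 : lam' = (κ * δ) • A (x - a) - (κ * δ * ε) • (lam - l) + β • A w := by
    have : A x - b = A (x - a) + ε • l := by rw [← hcrit.2, map_sub]; abel
    rw [hlam', this]
    module
  have h4 : κ • w + V' = (η - 1) • w - δ • g := by rw [hV']; module
  -- After this substitution the indefinite terms cancel: ⟨g, w⟩ by the choice of β, ⟨x - a, w⟩ by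
  -- the weight κ(1 - η), and ⟨lam - l, A w⟩ between the gap and the dual velocity. The remaining
  -- ⟨lam - l, A(x - a)⟩ is matched by `primalGap_add_le`.
  rw [h2, h3, h4, hV]
  have h5 := mul_le_mul_of_nonneg_left h1 hκδ
  simp only [inner_add_left, inner_add_right, inner_sub_right, inner_sub_left,
    real_inner_smul_left, real_inner_smul_right, ContinuousLinearMap.adjoint_inner_left,
    real_inner_self_eq_norm_sq, map_sub, norm_sub_sq_real] at h5 ⊢
  rw [real_inner_comm g w, real_inner_comm x g, real_inner_comm a g] at *
  rw [hβ]
  rw [real_inner_comm lam l] at *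
  nlinarith [h5]

/-- Effect on the energy of moving the reference point along the Tikhonov path. -/
theorem energy_shift_le (hf : ConvexOn ℝ univ f) (hd : Differentiable ℝ f)
    {κ β η ε₀ ε Δ : ℝ} {x V a a' : X} {lam l l' : Y} (hκ : 0 ≤ κ) (hβ : 0 ≤ β) (hη : η ≤ 1)
    (hε : 0 ≤ ε) (hcrit : IsCritical f A b ε₀ a l) (ha : ‖a - a'‖ ≤ Δ) (hl : ‖l - l'‖ ≤ Δ) :
    energy f A κ β η ε x V lam a' l' - energy f A κ β η ε x V lam a l
      ≤ β * (‖A‖ * Δ * ‖x - a‖ + ‖A‖ * Δ * Δ + |ε - ε₀| * ‖a‖ * Δ)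
        + (κ * Δ * ‖κ • (x - a) + V‖ + κ ^ 2 / 2 * Δ * Δ)
        + κ * (1 - η) * (Δ * ‖x - a‖ + Δ * Δ / 2) + (Δ * ‖lam - l‖ + Δ * Δ / 2) := by
  have hΔ : 0 ≤ Δ := (norm_nonneg _).trans ha
  have hX : ‖x - a'‖ ^ 2 ≤ ‖x - a‖ ^ 2 + 2 * (Δ * ‖x - a‖) + Δ * Δ := by
    have e : x - a' = (x - a) + (a - a') := by abel
    rw [e]
    have h1 : ‖(x - a) + (a - a')‖ ≤ ‖x - a‖ + Δ := (norm_add_le _ _).trans (by linarith)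
    nlinarith [pow_le_pow_left₀ (norm_nonneg _) h1 2]
  have hY : ‖lam - l'‖ ^ 2 ≤ ‖lam - l‖ ^ 2 + 2 * (Δ * ‖lam - l‖) + Δ * Δ := by
    have e : lam - l' = (lam - l) + (l - l') := by abel
    rw [e]
    have h1 : ‖(lam - l) + (l - l')‖ ≤ ‖lam - l‖ + Δ := (norm_add_le _ _).trans (by linarith)
    nlinarith [pow_le_pow_left₀ (norm_nonneg _) h1 2]
  have hVV : ‖κ • (x - a') + V‖ ^ 2 ≤ ‖κ • (x - a) + V‖ ^ 2
      + 2 * (κ * Δ * ‖κ • (x - a) + V‖) + κ ^ 2 * (Δ * Δ) := by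
    have e : κ • (x - a') + V = (κ • (x - a) + V) + κ • (a - a') := by module
    rw [e]
    have h0 : ‖κ • (a - a')‖ ≤ κ * Δ := by
      rw [norm_smul, Real.norm_of_nonneg hκ]
      gcongr
    have h1 : ‖(κ • (x - a) + V) + κ • (a - a')‖ ≤ ‖κ • (x - a) + V‖ + κ * Δ :=
      (norm_add_le _ _).trans (by linarith)
    nlinarith [pow_le_pow_left₀ (norm_nonneg _) h1 2]
  -- The old reference point is critical for ε₀ while the gap is taken at ε; replacing ∇f(a) through
  -- criticality leaves the mismatch |ε - ε₀|, which is of higher order once multiplied by Δ.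
  have hgap : primalGap f A ε x a' l' - primalGap f A ε x a l
      ≤ ‖A‖ * Δ * ‖x - a‖ + ‖A‖ * Δ * Δ + |ε - ε₀| * ‖a‖ * Δ := by
    have h1 := hf.add_inner_gradient_le hd a a'
    have h4 : gradient f a = - A.adjoint l - ε₀ • a := by
      rw [← sub_eq_zero, ← hcrit.1]; abel
    rw [h4, inner_sub_left, inner_neg_left, ContinuousLinearMap.adjoint_inner_left,
      real_inner_smul_left] at h1
    have h5 : ‖a'‖ ^ 2 = ‖a‖ ^ 2 + 2 * inner ℝ a (a' - a) + ‖a' - a‖ ^ 2 := by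
      rw [← norm_add_sq_real, add_sub_cancel]
    have h6 : ‖l' - l‖ ≤ Δ := by rwa [norm_sub_rev]
    have h7 : inner ℝ (l' - l) (A (x - a)) ≤ Δ * (‖A‖ * ‖x - a‖) :=
      (real_inner_le_norm _ _).trans (mul_le_mul h6 (A.le_opNorm _) (norm_nonneg _) hΔ)
    have h8 : inner ℝ (l' - l) (A (a - a')) ≤ Δ * (‖A‖ * Δ) :=
      (real_inner_le_norm _ _).trans (mul_le_mul h6
        ((A.le_opNorm _).trans (by gcongr)) (norm_nonneg _) hΔ)
    have h9 : (ε - ε₀) * inner ℝ a (a - a') ≤ |ε - ε₀| * (‖a‖ * Δ) :=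
      calc _ ≤ |(ε - ε₀) * inner ℝ a (a - a')| := le_abs_self _
        _ = |ε - ε₀| * |inner ℝ a (a - a')| := abs_mul _ _
        _ ≤ |ε - ε₀| * (‖a‖ * ‖a - a'‖) := by gcongr; exact abs_real_inner_le_norm _ _
        _ ≤ _ := by gcongr
    have h10 : 0 ≤ ε / 2 * ‖a' - a‖ ^ 2 := by positivity
    unfold primalGap
    rw [h5]
    simp only [inner_sub_left, inner_sub_right, map_sub] at *
    nlinarith
  have h1 := mul_le_mul_of_nonneg_left hgap hβ
  have h2 := mul_le_mul_of_nonneg_left hX (show 0 ≤ κ * (1 - η) / 2 from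
    div_nonneg (mul_nonneg hκ (by linarith)) (by norm_num))
  unfold energy
  linarith

/-- Upper Dini derivative of the energy relative to the Tikhonov path. -/
theorem eventually_slope_energy_lt (hf : ConvexOn ℝ univ f) (hd : Differentiable ℝ f)
    {κ : ℝ} (hκ : 0 ≤ κ) {β η ε : ℝ → ℝ} {x V xt : ℝ → X} {lam lt : ℝ → Y} {t ε' K D r : ℝ}
    (hε : HasDerivAt ε ε' t) (hβ : ContinuousAt β t) (hη : ContinuousAt η t)
    (hx : ContinuousAt x t) (hV : ContinuousAt V t) (hlam : ContinuousAt lam t)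
    (hD : HasDerivAt
      (fun s => energy f A κ (β s) (η s) (ε s) (x s) (V s) (lam s) (xt t) (lt t)) D t)
    (hεpos : ∀ s ≥ t, 0 < ε s) (hcrit : ∀ s ≥ t, IsCritical f A b (ε s) (xt s) (lt s))
    (hβ0 : ∀ᶠ s in 𝓝[>] t, 0 ≤ β s) (hη1 : ∀ᶠ s in 𝓝[>] t, η s ≤ 1)
    (hK : ‖WithLp.toLp 2 (xt t, lt t)‖ ≤ K)
    (hr : D + K * |ε'| / ε t * (β t * ‖A‖ * ‖x t - xt t‖ + κ * ‖κ • (x t - xt t) + V t‖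
      + κ * (1 - η t) * ‖x t - xt t‖ + ‖lam t - lt t‖) < r) :
    ∀ᶠ s in 𝓝[>] t,
      slope (fun s => energy f A κ (β s) (η s) (ε s) (x s) (V s) (lam s) (xt s) (lt s)) t s
        < r := by
  set a := xt t with ha
  set l := lt t with hl
  set F : ℝ → ℝ := fun s => energy f A κ (β s) (η s) (ε s) (x s) (V s) (lam s) a l with hF
  -- Q is the mean speed allowed to the path on [t, s], with limit K |ε'| / ε; Δ is the
  -- corresponding displacement.
  set Q : ℝ → ℝ := fun s => K * |slope ε t s| / ε s with hQ
  set Δ : ℝ → ℝ := fun s => (s - t) * Q s with hΔ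
  have hmono : 𝓝[>] t ≤ 𝓝[≠] t := nhdsWithin_mono t fun s hs => ne_of_gt hs
  have hn : 𝓝[>] t ≤ 𝓝 t := nhdsWithin_le_nhds
  have hslope : Tendsto (slope ε t) (𝓝[>] t) (𝓝 ε') := (hasDerivAt_iff_tendsto_slope.1 hε).mono_left hmono
  have hεt : Tendsto ε (𝓝[>] t) (𝓝 (ε t)) := hε.continuousAt.tendsto.mono_left hn
  have hε0 := hεpos t le_rfl
  have hQt : Tendsto Q (𝓝[>] t) (𝓝 (K * |ε'| / ε t)) :=
    (hslope.abs.const_mul K).div hεt hε0.ne'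
  have hst : Tendsto (fun s => s - t) (𝓝[>] t) (𝓝 0) := by
    have : Tendsto (fun s => s - t) (𝓝 t) (𝓝 (t - t)) := tendsto_id.sub_const t
    rw [sub_self] at this
    exact this.mono_left hn
  have hΔt : Tendsto Δ (𝓝[>] t) (𝓝 (0 * (K * |ε'| / ε t))) := hst.mul hQt
  rw [zero_mul] at hΔt
  have het : Tendsto (fun s => |ε s - ε t|) (𝓝[>] t) (𝓝 0) := by
    have := (hεt.sub_const (ε t)).abs
    simpa using this
  have hut : Tendsto (fun s => ‖x s - a‖) (𝓝[>] t) (𝓝 ‖x t - a‖) :=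
    ((hx.tendsto.mono_left hn).sub_const a).norm
  have hvt : Tendsto (fun s => ‖κ • (x s - a) + V s‖) (𝓝[>] t) (𝓝 ‖κ • (x t - a) + V t‖) :=
    ((((hx.tendsto.mono_left hn).sub_const a).const_smul κ).add (hV.tendsto.mono_left hn)).norm
  have hlt : Tendsto (fun s => ‖lam s - l‖) (𝓝[>] t) (𝓝 ‖lam t - l‖) :=
    ((hlam.tendsto.mono_left hn).sub_const l).norm
  have hβt := hβ.tendsto.mono_left hn
  have hηt := hη.tendsto.mono_left hn
  -- The bound of `energy_shift_le` divided by s - t. Terms with a second factor Δ or |ε s - ε t|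
  -- vanish in the limit, so the slope is at most the frozen slope plus Φ.
  set Φ : ℝ → ℝ := fun s =>
    β s * (‖A‖ * Q s * ‖x s - a‖ + ‖A‖ * Q s * Δ s + |ε s - ε t| * ‖a‖ * Q s)
        + (κ * Q s * ‖κ • (x s - a) + V s‖ + κ ^ 2 / 2 * Q s * Δ s)
        + κ * (1 - η s) * (Q s * ‖x s - a‖ + Q s * Δ s / 2)
        + (Q s * ‖lam s - l‖ + Q s * Δ s / 2) with hΦ
  have hΦt : Tendsto Φ (𝓝[>] t) (𝓝 (K * |ε'| / ε t * (β t * ‖A‖ * ‖x t - a‖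
      + κ * ‖κ • (x t - a) + V t‖ + κ * (1 - η t) * ‖x t - a‖ + ‖lam t - l‖))) := by
    have h1 := hβt.mul ((((hQt.const_mul ‖A‖).mul hut).add ((hQt.const_mul ‖A‖).mul hΔt)).add
      ((het.mul_const ‖a‖).mul hQt))
    have h2 := ((hQt.const_mul κ).mul hvt).add ((hQt.const_mul (κ ^ 2 / 2)).mul hΔt)
    have h3 := ((hηt.const_sub 1).const_mul κ).mul ((hQt.mul hut).add ((hQt.mul hΔt).div_const 2))
    have h4 := (hQt.mul hlt).add ((hQt.mul hΔt).div_const 2)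
    have h5 := ((h1.add h2).add h3).add h4
    refine h5.trans_eq ?_
    congr 1
    ring
  have htot := ((hasDerivAt_iff_tendsto_slope.1 hD).mono_left hmono).add hΦt
  filter_upwards [htot.eventually (gt_mem_nhds hr), hβ0, hη1, self_mem_nhdsWithin]
    with s hs hβs hηs hts
  have hts' : t < s := hts
  have hpos : 0 < s - t := sub_pos.2 hts'
  have hεs := hεpos s hts'.le
  have hlip : ‖WithLp.toLp 2 (a, l) - WithLp.toLp 2 (xt s, lt s)‖ ≤ Δ s := by
    have h1 := (isMonotoneOperator_saddleOperator (A := A) (b := b) hf hd).mul_norm_sub_le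
      (z₁ := WithLp.toLp 2 (a, l)) (z₂ := WithLp.toLp 2 (xt s, lt s))
      (saddleOperator_add_smul_eq_zero_iff.2 (hcrit t le_rfl))
      (saddleOperator_add_smul_eq_zero_iff.2 (hcrit s hts'.le))
    have h2 : Δ s = |ε s - ε t| * K / ε s := by
      simp only [hΔ, hQ, slope_def_field, abs_div, abs_of_pos hpos]
      field_simp
    rw [h2, le_div_iff₀ hεs, mul_comm]
    exact h1.trans (by gcongr)
  have hfst : ‖a - xt s‖ ≤ Δ s := le_trans (by
    simpa using WithLp.norm_fst_le (p := 2) X (WithLp.toLp 2 (a, l) - WithLp.toLp 2 (xt s, lt s))) hlip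
  have hsnd : ‖l - lt s‖ ≤ Δ s := le_trans (by
    simpa using WithLp.norm_snd_le (p := 2) X (WithLp.toLp 2 (a, l) - WithLp.toLp 2 (xt s, lt s))) hlip
  have hshift := energy_shift_le (x := x s) (V := V s) (lam := lam s) hf hd hκ hβs hηs hεs.le
    (hcrit t le_rfl) hfst hsnd
  refine lt_of_le_of_lt ?_ hs
  rw [slope_def_field, slope_def_field, div_add' _ _ _ hpos.ne', div_le_div_iff_of_pos_right hpos]
  have hΦs : Φ s * (s - t) = β s * (‖A‖ * Δ s * ‖x s - a‖ + ‖A‖ * Δ s * Δ s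
        + |ε s - ε t| * ‖a‖ * Δ s)
        + (κ * Δ s * ‖κ • (x s - a) + V s‖ + κ ^ 2 / 2 * Δ s * Δ s)
        + κ * (1 - η s) * (Δ s * ‖x s - a‖ + Δ s * Δ s / 2)
        + (Δ s * ‖lam s - l‖ + Δ s * Δ s / 2) := by
    simp only [hΦ, hΔ]
    ring
  rw [hΦs]
  linarith

end Energy

/-! ### Scalar inequalities: absorption by damping and fencing -/

section Scalar

theorem mul_le_add_sq_div {d : ℝ} (hd : 0 < d) (y u : ℝ) : y * u ≤ d * u ^ 2 + y ^ 2 / (4 * d) := by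
  have h : 0 ≤ (2 * d * u - y) ^ 2 / (4 * d) := by positivity
  have e : (2 * d * u - y) ^ 2 / (4 * d) = d * u ^ 2 - y * u + y ^ 2 / (4 * d) := by
    field_simp
    ring
  linarith

theorem add_add_sq_le (x y w : ℝ) : (x + y + w) ^ 2 ≤ 3 * (x ^ 2 + y ^ 2 + w ^ 2) := by
  nlinarith [sq_nonneg (x - y), sq_nonneg (x - w), sq_nonneg (y - w)]

set_option maxHeartbeats 1000000 in
/-- The damping terms dominate the energy and absorb the forcing terms. -/
theorem damping_estimate {κ γ c k C θ : ℝ} (hκ : 0 < κ) (hγ : 0 < γ) (hθ : 0 < θ)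
    (hθ1 : θ * (10 * k) ≤ κ) (hθ2 : θ * (12 * κ + 6) ≤ c) (hθ3 : θ * (6 * k) ≤ 1)
    (hθ4 : θ * (6 * γ) ≤ 1) (hθ5 : θ * 2 ≤ κ * c)
    {t τ ρ P e z δ β β' η η' D U Λ W G N Fo : ℝ} (ht : 0 < t) (hτ : 0 < τ) (hρ : 0 < ρ)
    (hρk : ρ ≤ k) (hP : 0 < P) (hPτ : P ≤ τ) (he : 0 < e) (hz : 0 < z) (hz1 : z ≤ 1)
    (hze : c * z ≤ τ * e) (hργ : γ * P ≤ ρ * τ) (hδ : τ / 2 ≤ δ) (hη : |η| ≤ 1 / 2)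
    (hβ' : β' ≤ κ * δ / 2) (hη' : 8 * |η'| ≤ τ * e) (hβ : β ≤ 5 / 2 * (ρ * τ))
    (hD : 0 ≤ D) (hN0 : 0 ≤ N) (hN : N ≤ κ * U + ρ * W + γ * P * G)
    (hF : Fo ≤ C / t * (ρ * τ * U + ρ * τ * Λ + ρ * W + P * G)) :
    (β' - κ * δ) * D - κ * δ * (e / 2 * U ^ 2 + e * Λ ^ 2) - (1 - η) * ρ * W ^ 2
        - γ * P * δ * G ^ 2 - κ * η' / 2 * U ^ 2 + Fo
      ≤ -(θ * z) * (β * D + 1 / 2 * N ^ 2 + κ * (1 - η) / 2 * U ^ 2 + 1 / 2 * Λ ^ 2)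
        + (8 * C ^ 2 / κ * (τ * ρ ^ 2 / (e * t ^ 2))
          + (C ^ 2 + C ^ 2 / γ ^ 2) * (ρ / t ^ 2)) := by
  obtain ⟨hη1, hη2⟩ := abs_le.1 hη
  -- Here τ = t^(q+s), ρ = t^q m, P = t^q, e = c / t^p and z = t^(-r). Young's inequality charges
  -- each linear forcing term to a fraction of its damping; enough is left for the drift of η and
  -- for θz times the energy. The bounds `hθ1` to `hθ5` serve D, U, W, G and Λ respectively.
  have hU := mul_le_add_sq_div (show 0 < κ * τ * e / 16 by positivity) (C / t * (ρ * τ)) U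
  have hΛ := mul_le_add_sq_div (show 0 < κ * τ * e / 16 by positivity) (C / t * (ρ * τ)) Λ
  have hW := mul_le_add_sq_div (show 0 < ρ / 4 by positivity) (C / t * ρ) W
  have hG := mul_le_add_sq_div (show 0 < γ / 4 * P * τ by positivity) (C / t * P) G
  have eU : (C / t * (ρ * τ)) ^ 2 / (4 * (κ * τ * e / 16))
      = 4 * C ^ 2 / κ * (τ * ρ ^ 2 / (e * t ^ 2)) := by
    field_simp
    ring
  have eW : (C / t * ρ) ^ 2 / (4 * (ρ / 4)) = C ^ 2 * (ρ / t ^ 2) := by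
    field_simp
  have eG : (C / t * P) ^ 2 / (4 * (γ / 4 * P * τ)) ≤ C ^ 2 / γ ^ 2 * (ρ / t ^ 2) := by
    have e1 : (C / t * P) ^ 2 / (4 * (γ / 4 * P * τ)) = C ^ 2 / (γ * t ^ 2) * (P / τ) := by
      field_simp
    have e2 : C ^ 2 / γ ^ 2 * (ρ / t ^ 2) = C ^ 2 / (γ * t ^ 2) * (ρ / γ) := by
      field_simp
    rw [e1, e2]
    refine mul_le_mul_of_nonneg_left ?_ (by positivity)
    rw [div_le_div_iff₀ hτ hγ]
    linarith
  rw [eU] at hU hΛ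
  rw [eW] at hW
  have hN2 : N ^ 2 ≤ 3 * (κ ^ 2 * U ^ 2 + ρ ^ 2 * W ^ 2 + γ ^ 2 * P ^ 2 * G ^ 2) := by
    have h1 := pow_le_pow_left₀ hN0 hN 2
    have h2 := add_add_sq_le (κ * U) (ρ * W) (γ * P * G)
    calc N ^ 2 ≤ _ := h1
      _ ≤ _ := h2
      _ = _ := by ring
  have hθz : 0 < θ * z := mul_pos hθ hz
  have hθzle : θ * z ≤ θ := mul_le_of_le_one_right hθ.le hz1
  have hE : θ * z * (β * D + 1 / 2 * N ^ 2 + κ * (1 - η) / 2 * U ^ 2 + 1 / 2 * Λ ^ 2)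
      ≤ κ * τ / 4 * D + κ * τ * e / 8 * U ^ 2 + ρ / 4 * W ^ 2 + γ / 4 * P * τ * G ^ 2
        + κ * τ * e / 4 * Λ ^ 2 := by
    have d1 : θ * z * (β * D) ≤ κ * τ / 4 * D := by
      have : θ * z * β ≤ κ * τ / 4 :=
        calc θ * z * β ≤ θ * z * (5 / 2 * (ρ * τ)) := by gcongr
          _ ≤ θ * (5 / 2 * (k * τ)) := by gcongr
          _ = θ * (10 * k) * (τ / 4) := by ring
          _ ≤ κ * (τ / 4) := by gcongr
          _ = _ := by ring
      calc _ = θ * z * β * D := by ring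
        _ ≤ _ := mul_le_mul_of_nonneg_right this hD
    have d2 : θ * z * (3 / 2 * κ ^ 2 + κ * (1 - η) / 2) ≤ κ * τ * e / 8 :=
      calc θ * z * (3 / 2 * κ ^ 2 + κ * (1 - η) / 2)
          ≤ θ * z * (3 / 2 * κ ^ 2 + κ * (3 / 2) / 2) := by gcongr; linarith
        _ = θ * (12 * κ + 6) * (κ * z / 8) := by ring
        _ ≤ c * (κ * z / 8) := by gcongr
        _ = κ / 8 * (c * z) := by ring
        _ ≤ κ / 8 * (τ * e) := by gcongr
        _ = _ := by ring
    have d3 : θ * z * (3 / 2 * ρ ^ 2) ≤ ρ / 4 :=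
      calc θ * z * (3 / 2 * ρ ^ 2) ≤ θ * (3 / 2 * (k * ρ)) := by
            rw [sq]; gcongr
        _ = θ * (6 * k) * (ρ / 4) := by ring
        _ ≤ 1 * (ρ / 4) := by gcongr
        _ = _ := by ring
    have d4 : θ * z * (3 / 2 * (γ ^ 2 * P ^ 2)) ≤ γ / 4 * P * τ :=
      calc θ * z * (3 / 2 * (γ ^ 2 * P ^ 2)) ≤ θ * (3 / 2 * (γ ^ 2 * (P * τ))) := by
            rw [sq P]; gcongr
        _ = θ * (6 * γ) * (γ / 4 * P * τ) := by ring
        _ ≤ 1 * (γ / 4 * P * τ) := by gcongr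
        _ = _ := by ring
    have d5 : θ * z * (1 / 2) ≤ κ * τ * e / 4 :=
      calc θ * z * (1 / 2) = θ * 2 * (z / 4) := by ring
        _ ≤ κ * c * (z / 4) := by gcongr
        _ = κ / 4 * (c * z) := by ring
        _ ≤ κ / 4 * (τ * e) := by gcongr
        _ = _ := by ring
    have f1 := mul_le_mul_of_nonneg_left hN2 hθz.le
    have f2 := mul_le_mul_of_nonneg_right d2 (sq_nonneg U)
    have f3 := mul_le_mul_of_nonneg_right d3 (sq_nonneg W)
    have f4 := mul_le_mul_of_nonneg_right d4 (sq_nonneg G)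
    have f5 := mul_le_mul_of_nonneg_right d5 (sq_nonneg Λ)
    linarith only [d1, f1, f2, f3, f4, f5]
  have g1 : (β' - κ * δ) * D ≤ -(κ * τ / 4) * D := by
    have h1 := mul_le_mul_of_nonneg_left hδ hκ.le
    have : β' - κ * δ ≤ -(κ * τ / 4) := by linarith only [h1, hβ']
    exact mul_le_mul_of_nonneg_right this hD
  have g2 : κ * δ * (e / 2 * U ^ 2 + e * Λ ^ 2)
      ≥ κ * (τ / 2) * (e / 2 * U ^ 2 + e * Λ ^ 2) := by gcongr
  have g3 : (1 - η) * ρ * W ^ 2 ≥ 1 / 2 * ρ * W ^ 2 := by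
    gcongr
    linarith
  have g4 : γ * P * δ * G ^ 2 ≥ γ * P * (τ / 2) * G ^ 2 := by gcongr
  have g5 : -(κ * η' / 2 * U ^ 2) ≤ κ * τ * e / 16 * U ^ 2 := by
    have h1 : -η' ≤ τ * e / 8 := by linarith [neg_le_abs η']
    have h2 : 0 ≤ κ * U ^ 2 := by positivity
    have h3 := mul_le_mul_of_nonneg_right h1 h2
    linarith only [h3]
  have g6 : 0 ≤ κ * τ * e * Λ ^ 2 := by positivity
  have hF' : Fo ≤ C / t * (ρ * τ) * U + C / t * (ρ * τ) * Λ + C / t * ρ * W + C / t * P * G :=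
    hF.trans_eq (by ring)
  have hG' := hG.trans (add_le_add le_rfl eG)
  have e1 : 8 * C ^ 2 / κ * (τ * ρ ^ 2 / (e * t ^ 2))
      = 2 * (4 * C ^ 2 / κ * (τ * ρ ^ 2 / (e * t ^ 2))) := by ring
  have e2 : (C ^ 2 + C ^ 2 / γ ^ 2) * (ρ / t ^ 2)
      = C ^ 2 * (ρ / t ^ 2) + C ^ 2 / γ ^ 2 * (ρ / t ^ 2) := add_mul _ _ _
  rw [e1, e2, neg_mul (θ * z)]
  clear hG eG eU eW hF hN2 hN e1 e2
  generalize θ * z * (β * D + 1 / 2 * N ^ 2 + κ * (1 - η) / 2 * U ^ 2 + 1 / 2 * Λ ^ 2) = E1 at *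
  generalize 4 * C ^ 2 / κ * (τ * ρ ^ 2 / (e * t ^ 2)) = R1 at *
  generalize C ^ 2 * (ρ / t ^ 2) = R2 at *
  generalize C ^ 2 / γ ^ 2 * (ρ / t ^ 2) = R3 at *
  generalize C / t * (ρ * τ) * U = F1 at *
  generalize C / t * (ρ * τ) * Λ = F2 at *
  generalize C / t * ρ * W = F3 at *
  generalize C / t * P * G = F4 at *
  linarith only [hU, hΛ, hW, hG', hE, g1, g2, g3, g4, g5, g6, hF']

/-- Fencing by a slowly varying function for a Dini differential inequality. -/
theorem exists_le_mul_of_slope_lt {E G G' : ℝ → ℝ} {T θ C C' r : ℝ} (hT : 0 < T) (hθ : 0 < θ)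
    (hr : r < 1) (hE : ContinuousOn E (Ici T))
    (hslope : ∀ t ≥ T, ∀ y, -(θ * t ^ (-r)) * E t + C * (t ^ (-r) * G t) < y →
      ∀ᶠ u in 𝓝[>] t, slope E t u < y)
    (hG : ∀ t ≥ T, 0 < G t) (hGd : ∀ t ≥ T, HasDerivAt G (G' t) t)
    (hG' : ∀ t ≥ T, t * |G' t| ≤ C' * G t) :
    ∃ M, ∀ᶠ t in atTop, E t ≤ M * G t := by
  have hlim : Tendsto (fun t : ℝ => t ^ (1 - r)) atTop atTop :=
    tendsto_rpow_atTop (by linarith)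
  -- Beyond T' half of the decay rate θ t^(-r) exceeds the bound C' / t on the logarithmic
  -- derivative of G.
  obtain ⟨T', hT'⟩ := eventually_atTop.1
    ((hlim.eventually_gt_atTop (2 * C' / θ)).and (eventually_ge_atTop T))
  have hTT' : T ≤ T' := (hT' T' le_rfl).2
  -- The three entries let the other half of the decay absorb the source term, keep M positive, and
  -- start E below the fence at T'.
  set M := max (max (2 * C / θ) 1) (E T' / G T') with hM
  have hM1 : 1 ≤ M := (le_max_right _ _).trans (le_max_left _ _)
  have hM2 : 2 * C / θ ≤ M := (le_max_left _ _).trans (le_max_left _ _)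
  have hM3 : E T' / G T' ≤ M := le_max_right _ _
  refine ⟨M, ?_⟩
  filter_upwards [eventually_ge_atTop T'] with t₁ ht₁
  refine image_le_of_liminf_slope_right_lt_deriv_boundary' (a := T') (b := t₁) (f := E)
    (f' := fun t => -(θ * t ^ (-r)) * E t + C * (t ^ (-r) * G t))
    (B := fun t => M * G t) (B' := fun t => M * G' t) ?_ ?_ ?_ ?_ ?_ ?_ ⟨ht₁, le_rfl⟩
  · exact hE.mono fun t ht => hTT'.trans ht.1
  · intro t ht y hy
    exact (hslope t (hTT'.trans ht.1) y hy).frequently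
  · rwa [div_le_iff₀ (hG T' hTT')] at hM3
  · intro t ht
    exact ((hGd t (hTT'.trans ht.1)).const_mul M).continuousAt.continuousWithinAt
  · intro t ht
    exact ((hGd t (hTT'.trans ht.1)).const_mul M).hasDerivWithinAt
  -- Strict inequality is needed only at contact, where E = M G.
  · intro t ht hEt
    have htT := hTT'.trans ht.1
    have ht0 : 0 < t := hT.trans_le htT
    have hGt := hG t htT
    have h1 := (hT' t ht.1).1
    rw [div_lt_iff₀ hθ] at h1
    have hz : 0 < t ^ (-r) := Real.rpow_pos_of_pos ht0 _
    have h2 : t ^ (1 - r) = t * t ^ (-r) := by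
      rw [sub_eq_add_neg, Real.rpow_add ht0, Real.rpow_one]
    rw [h2] at h1
    have h3 := hG' t htT
    have h4 : -|G' t| ≤ G' t := neg_abs_le _
    rw [div_le_iff₀ hθ] at hM2
    simp only [hEt]
    refine lt_of_mul_lt_mul_left (a := t) ?_ ht0.le
    have h5 : t * (M * G' t) ≥ - (M * (C' * G t)) := by
      have : t * G' t ≥ -(C' * G t) := by nlinarith
      nlinarith
    have h6 : 2 * C * (t * t ^ (-r) * G t) ≤ M * θ * (t * t ^ (-r) * G t) :=
      mul_le_mul_of_nonneg_right hM2 (by positivity)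
    have h7 : 2 * C' * (M * G t) < t * t ^ (-r) * θ * (M * G t) :=
      mul_lt_mul_of_pos_right h1 (by positivity)
    linarith

end Scalar

/-! ### Time-dependent coefficients and their asymptotic bounds -/

section Coefficients

/-- The derivative of `t ^ q * m t`, where `m₁` is the derivative of `m`. -/
def massRate (q : ℝ) (m m₁ : ℝ → ℝ) (t : ℝ) : ℝ := q * t ^ (q - 1) * m t + t ^ q * m₁ t

/-- The derivative of `massRate`. -/
def massRateDeriv (q : ℝ) (m m₁ m₂ : ℝ → ℝ) (t : ℝ) : ℝ :=
  q * (q - 1) * t ^ (q - 2) * m t + 2 * q * t ^ (q - 1) * m₁ t + t ^ q * m₂ t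

/-- The damping coefficient `t ^ (q + s) - γ q t ^ (q - 1)`. -/
def dampingCoeff (γ q s t : ℝ) : ℝ := t ^ (q + s) - γ * q * t ^ (q - 1)

/-- The derivative of `dampingCoeff`. -/
def dampingCoeffDeriv (γ q s t : ℝ) : ℝ :=
  (q + s) * t ^ (q + s - 1) - γ * q * ((q - 1) * t ^ (q - 2))

/-- The weight of the primal gap in the energy. -/
def gapWeight (γ q s : ℝ) (m m₁ : ℝ → ℝ) (t : ℝ) : ℝ :=
  dampingCoeff γ q s t * (t ^ q * m t) + (1 - massRate q m m₁ t) * (γ * t ^ q)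

/-- The derivative of `gapWeight`. -/
def gapWeightDeriv (γ q s : ℝ) (m m₁ m₂ : ℝ → ℝ) (t : ℝ) : ℝ :=
  dampingCoeffDeriv γ q s t * (t ^ q * m t) + dampingCoeff γ q s t * massRate q m m₁ t
    + (-massRateDeriv q m m₁ m₂ t * (γ * t ^ q)
      + (1 - massRate q m m₁ t) * (γ * (q * t ^ (q - 1))))

variable {γ q s t : ℝ} {m m₁ m₂ : ℝ → ℝ}

theorem hasDerivAt_rpow_mul (ht : 0 < t) (h : HasDerivAt m (m₁ t) t) :
    HasDerivAt (fun u => u ^ q * m u) (massRate q m m₁ t) t := by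
  have h1 := Real.hasDerivAt_rpow_const (p := q) (Or.inl ht.ne')
  exact h1.mul h

theorem hasDerivAt_massRate (ht : 0 < t) (h : HasDerivAt m (m₁ t) t)
    (h' : HasDerivAt m₁ (m₂ t) t) : HasDerivAt (massRate q m m₁) (massRateDeriv q m m₁ m₂ t) t := by
  have h1 := Real.hasDerivAt_rpow_const (p := q) (Or.inl ht.ne')
  have h2 := Real.hasDerivAt_rpow_const (p := q - 1) (Or.inl ht.ne')
  have h3 := ((h2.const_mul q).mul h).add (h1.mul h')
  refine h3.congr_deriv ?_
  unfold massRateDeriv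
  rw [show q - 1 - 1 = q - 2 by ring]
  ring

theorem hasDerivAt_dampingCoeff (ht : 0 < t) :
    HasDerivAt (dampingCoeff γ q s) (dampingCoeffDeriv γ q s t) t := by
  have h1 := Real.hasDerivAt_rpow_const (p := q + s) (Or.inl ht.ne')
  have h2 := Real.hasDerivAt_rpow_const (p := q - 1) (Or.inl ht.ne')
  have h3 := h1.sub (h2.const_mul (γ * q))
  refine h3.congr_deriv ?_
  unfold dampingCoeffDeriv
  rw [show q - 1 - 1 = q - 2 by ring]

theorem hasDerivAt_gapWeight (ht : 0 < t) (h : HasDerivAt m (m₁ t) t)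
    (h' : HasDerivAt m₁ (m₂ t) t) :
    HasDerivAt (gapWeight γ q s m m₁) (gapWeightDeriv γ q s m m₁ m₂ t) t := by
  have h1 := Real.hasDerivAt_rpow_const (p := q) (Or.inl ht.ne')
  exact ((hasDerivAt_dampingCoeff ht).mul (hasDerivAt_rpow_mul ht h)).add
    (((hasDerivAt_massRate ht h h').const_sub 1).mul (h1.const_mul γ))

/-- Bounds on the coefficients of the energy for large times. -/
structure CoefficientBounds (κ γ q s k C : ℝ) (m m₁ m₂ : ℝ → ℝ) (t : ℝ) : Prop where
  one_le : 1 ≤ t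
  mass_pos : 0 < t ^ q * m t
  mass_le : t ^ q * m t ≤ k
  le_mass : γ * t ^ q ≤ t ^ q * m t * t ^ (q + s)
  rpow_le : t ^ q ≤ t ^ (q + s)
  le_damping : t ^ (q + s) / 2 ≤ dampingCoeff γ q s t
  rate_le : |massRate q m m₁ t| ≤ 1 / 2
  rateDeriv_le : t ^ 2 * |massRateDeriv q m m₁ m₂ t| ≤ C
  weight_nonneg : 0 ≤ gapWeight γ q s m m₁ t
  weight_le : gapWeight γ q s m m₁ t ≤ 5 / 2 * (t ^ q * m t * t ^ (q + s))
  weightDeriv_le : gapWeightDeriv γ q s m m₁ m₂ t ≤ κ * dampingCoeff γ q s t / 2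

-- Since t|m'| and t²|m''| are at most k₂ m and t^q m ≤ k₁, each derivative costs a factor 1/t. So η
-- tends to 0 and the derivative of the gap weight is O(t^(q+s-1)), eventually at most half of κδ.
-- The lower bound on m gives γ t^q ≤ t^q m t^(q+s).
set_option maxHeartbeats 1000000 in
theorem eventually_coefficientBounds {κ γ q s k₁ k₂ : ℝ} (hκ : 0 < κ) (hγ : 0 < γ) (hq : 0 < q)
    (hq1 : q < 1) (hs : 0 < s) (hk₁ : 0 < k₁) (hk₂ : 0 < k₂)
    (hm : ∀ᶠ t in atTop, 0 < m t) (hlo : ∀ᶠ t in atTop, γ / t ^ (q + s) ≤ m t)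
    (hup : ∀ᶠ t in atTop, m t ≤ k₁ / t ^ q) (hm₁ : ∀ᶠ t in atTop, t * |m₁ t| ≤ k₂ * m t)
    (hm₂ : ∀ᶠ t in atTop, t ^ 2 * |m₂ t| ≤ k₂ * m t) :
    ∀ᶠ t in atTop, CoefficientBounds κ γ q s k₁ ((1 + 3 * k₂) * k₁) m m₁ m₂ t := by
  set C₁ := (1 + 3 * k₂) * k₁ with hC₁
  set C₂ := (q + s + γ) * k₁ + (1 + k₂) * k₁ + C₁ * γ + 3 / 2 * γ with hC₂
  filter_upwards [hm, hlo, hup, hm₁, hm₂, eventually_ge_atTop 1, eventually_ge_atTop (2 * γ),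
    eventually_ge_atTop (2 * ((1 + k₂) * k₁)), eventually_ge_atTop (4 * C₂ / κ)]
    with t hmt hlot hupt hm₁t hm₂t ht1 htγ htk htC
  have ht : 0 < t := by linarith
  have eP1 : t ^ (q - 1) = t ^ q / t := by rw [Real.rpow_sub ht, Real.rpow_one]
  have eP2 : t ^ (q - 2) = t ^ q / t ^ 2 := by
    rw [Real.rpow_sub ht, Real.rpow_ofNat]
  have eτ1 : t ^ (q + s - 1) = t ^ (q + s) / t := by rw [Real.rpow_sub ht, Real.rpow_one]
  have hPτ : t ^ q ≤ t ^ (q + s) := Real.rpow_le_rpow_of_exponent_le ht1 (by linarith)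
  have hP : 0 < t ^ q := Real.rpow_pos_of_pos ht q
  have hτ : 0 < t ^ (q + s) := Real.rpow_pos_of_pos ht _
  have hC₁0 : 0 < C₁ := by positivity
  rw [div_le_iff₀ hτ] at hlot
  rw [le_div_iff₀ hP] at hupt
  rw [div_le_iff₀ hκ] at htC
  have hmass : 0 < t ^ q * m t := mul_pos hP hmt
  have hmassle : t ^ q * m t ≤ k₁ := by rw [mul_comm]; exact hupt
  have hlemass : γ * t ^ q ≤ t ^ q * m t * t ^ (q + s) := by
    have := mul_le_mul_of_nonneg_left hlot hP.le
    linarith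
  have hrate : t * |massRate q m m₁ t| ≤ (1 + k₂) * k₁ := by
    unfold massRate
    rw [eP1, ← abs_of_pos ht, ← abs_mul, abs_of_pos ht]
    have e : t * (q * (t ^ q / t) * m t + t ^ q * m₁ t)
        = q * (t ^ q * m t) + t ^ q * (t * m₁ t) := by field_simp
    rw [e]
    calc |q * (t ^ q * m t) + t ^ q * (t * m₁ t)|
        ≤ |q * (t ^ q * m t)| + |t ^ q * (t * m₁ t)| := abs_add_le _ _
      _ = q * (t ^ q * m t) + t ^ q * (t * |m₁ t|) := by
          rw [abs_of_pos (mul_pos hq hmass), abs_mul, abs_mul, abs_of_pos hP, abs_of_pos ht]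
      _ ≤ 1 * (t ^ q * m t) + t ^ q * (k₂ * m t) := by gcongr
      _ = (1 + k₂) * (t ^ q * m t) := by ring
      _ ≤ (1 + k₂) * k₁ := by gcongr
  have hrate' : t ^ 2 * |massRateDeriv q m m₁ m₂ t| ≤ C₁ := by
    unfold massRateDeriv
    rw [eP1, eP2, ← abs_of_pos (pow_pos ht 2), ← abs_mul, abs_of_pos (pow_pos ht 2)]
    have e : t ^ 2 * (q * (q - 1) * (t ^ q / t ^ 2) * m t + 2 * q * (t ^ q / t) * m₁ t
        + t ^ q * m₂ t)
        = q * (q - 1) * (t ^ q * m t) + 2 * q * t ^ q * (t * m₁ t) + t ^ q * (t ^ 2 * m₂ t) := by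
      field_simp
    rw [e]
    have hq2 : |q * (q - 1)| ≤ 1 := by
      rw [abs_mul, abs_of_pos hq, abs_of_neg (by linarith)]
      exact mul_le_one₀ hq1.le (by linarith) (by linarith)
    calc |q * (q - 1) * (t ^ q * m t) + 2 * q * t ^ q * (t * m₁ t) + t ^ q * (t ^ 2 * m₂ t)|
        ≤ |q * (q - 1) * (t ^ q * m t)| + |2 * q * t ^ q * (t * m₁ t)|
          + |t ^ q * (t ^ 2 * m₂ t)| := abs_add_three _ _ _
      _ = |q * (q - 1)| * (t ^ q * m t) + 2 * q * t ^ q * (t * |m₁ t|)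
          + t ^ q * (t ^ 2 * |m₂ t|) := by
          rw [abs_mul (q * (q - 1)), abs_of_pos hmass, abs_mul (2 * q * t ^ q), abs_mul t,
            abs_of_pos (show 0 < 2 * q * t ^ q by positivity), abs_of_pos ht,
            abs_mul (t ^ q), abs_mul (t ^ 2), abs_of_pos hP, abs_of_pos (pow_pos ht 2)]
      _ ≤ 1 * (t ^ q * m t) + 2 * 1 * t ^ q * (k₂ * m t) + t ^ q * (k₂ * m t) := by gcongr
      _ = (1 + 3 * k₂) * (t ^ q * m t) := by ring
      _ ≤ (1 + 3 * k₂) * k₁ := by gcongr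
  have hrate2 : |massRate q m m₁ t| ≤ 1 / 2 := by
    refine le_of_mul_le_mul_left ?_ ht
    linarith
  obtain ⟨hr1, hr2⟩ := abs_le.1 hrate2
  have hsmall : 0 ≤ γ * q * t ^ (q - 1) ∧ γ * q * t ^ (q - 1) ≤ t ^ (q + s) / 2 := by
    rw [eP1]
    refine ⟨by positivity, ?_⟩
    calc γ * q * (t ^ q / t) ≤ γ * 1 * (t ^ (q + s) / t) := by gcongr
      _ = γ / t * t ^ (q + s) := by ring
      _ ≤ 1 / 2 * t ^ (q + s) := by
        refine mul_le_mul_of_nonneg_right ?_ hτ.le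
        rw [div_le_div_iff₀ ht two_pos]
        linarith only [htγ]
      _ = _ := by ring
  have hδ1 : t ^ (q + s) / 2 ≤ dampingCoeff γ q s t := by
    unfold dampingCoeff; linarith [hsmall.2]
  have hδ2 : dampingCoeff γ q s t ≤ t ^ (q + s) := by
    unfold dampingCoeff; linarith [hsmall.1]
  have hδ0 : 0 < dampingCoeff γ q s t := by linarith
  refine ⟨ht1, hmass, hmassle, hlemass, hPτ, hδ1, hrate2, hrate', ?_, ?_, ?_⟩
  · unfold gapWeight
    have : 0 ≤ 1 - massRate q m m₁ t := by linarith
    positivity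
  · unfold gapWeight
    have h1 : dampingCoeff γ q s t * (t ^ q * m t) ≤ t ^ (q + s) * (t ^ q * m t) := by gcongr
    have h2 : (1 - massRate q m m₁ t) * (γ * t ^ q) ≤ 3 / 2 * (γ * t ^ q) := by
      gcongr; linarith
    linarith
  · have hδ' : t * dampingCoeffDeriv γ q s t ≤ (q + s + γ) * t ^ (q + s) := by
      unfold dampingCoeffDeriv
      rw [eτ1, eP2]
      have e : t * ((q + s) * (t ^ (q + s) / t) - γ * q * ((q - 1) * (t ^ q / t ^ 2)))
          = (q + s) * t ^ (q + s) + γ * (q * (1 - q)) * (t ^ q / t) := by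
        field_simp
        ring
      rw [e]
      have h1 : t ^ q / t ≤ t ^ (q + s) := (div_le_self hP.le ht1).trans hPτ
      have h2 : 0 ≤ q * (1 - q) := mul_nonneg hq.le (by linarith)
      have h3 : q * (1 - q) ≤ 1 := mul_le_one₀ hq1.le (by linarith) (by linarith)
      calc (q + s) * t ^ (q + s) + γ * (q * (1 - q)) * (t ^ q / t)
          ≤ (q + s) * t ^ (q + s) + γ * 1 * t ^ (q + s) := by gcongr
        _ = _ := by ring
    have a1 : t * (dampingCoeffDeriv γ q s t * (t ^ q * m t))
        ≤ (q + s + γ) * k₁ * t ^ (q + s) :=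
      calc _ = t * dampingCoeffDeriv γ q s t * (t ^ q * m t) := by ring
        _ ≤ (q + s + γ) * t ^ (q + s) * (t ^ q * m t) := by gcongr
        _ ≤ (q + s + γ) * t ^ (q + s) * k₁ := by gcongr
        _ = _ := by ring
    have a2 : t * (dampingCoeff γ q s t * massRate q m m₁ t) ≤ (1 + k₂) * k₁ * t ^ (q + s) :=
      calc _ ≤ t * (dampingCoeff γ q s t * |massRate q m m₁ t|) := by
            gcongr; exact le_abs_self _
        _ = dampingCoeff γ q s t * (t * |massRate q m m₁ t|) := by ring
        _ ≤ t ^ (q + s) * ((1 + k₂) * k₁) := by gcongr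
        _ = _ := by ring
    have a3 : t * (-massRateDeriv q m m₁ m₂ t * (γ * t ^ q)) ≤ C₁ * γ * t ^ (q + s) :=
      calc _ ≤ t * (|massRateDeriv q m m₁ m₂ t| * (γ * t ^ q)) := by
            gcongr; exact neg_le_abs _
        _ ≤ t ^ 2 * (|massRateDeriv q m m₁ m₂ t| * (γ * t ^ q)) := by
            gcongr; exact le_self_pow₀ ht1 two_ne_zero
        _ = t ^ 2 * |massRateDeriv q m m₁ m₂ t| * (γ * t ^ q) := by ring
        _ ≤ C₁ * (γ * t ^ (q + s)) := by gcongr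
        _ = _ := by ring
    have a4 : t * ((1 - massRate q m m₁ t) * (γ * (q * t ^ (q - 1))))
        ≤ 3 / 2 * γ * t ^ (q + s) := by
      rw [eP1]
      calc t * ((1 - massRate q m m₁ t) * (γ * (q * (t ^ q / t))))
          = (1 - massRate q m m₁ t) * (γ * (q * t ^ q)) := by field_simp
        _ ≤ 3 / 2 * (γ * (1 * t ^ (q + s))) := by gcongr; linarith
        _ = _ := by ring
    have a5 : t * gapWeightDeriv γ q s m m₁ m₂ t ≤ C₂ * t ^ (q + s) := by
      unfold gapWeightDeriv
      rw [hC₂]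
      linarith
    refine le_of_mul_le_mul_left ?_ ht
    clear hrate hrate' hm₁t hm₂t hlot hupt
    have a6 : C₂ * t ^ (q + s) ≤ t * κ / 4 * t ^ (q + s) := by
      gcongr
      linarith
    have a7 : t * κ * (t ^ (q + s) / 2) ≤ t * κ * dampingCoeff γ q s t := by gcongr
    linarith

/-- The forcing terms in the energy inequality. -/
theorem forcing_le {κ γ c p K a : ℝ} (hκ : 0 ≤ κ) (hγ : 0 < γ) (hp : 0 ≤ p) (hK : 0 ≤ K)
    (ha : 0 ≤ a) {t τ ρ P e β η U Λ W G N S : ℝ} (ht : 0 < t) (he : 0 ≤ e) (hec : e ≤ c)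
    (hγρ : γ ≤ ρ * τ) (hρ : 0 ≤ ρ) (hP : 0 ≤ P) (hη : |η| ≤ 1 / 2) (hβ0 : 0 ≤ β)
    (hβ : β ≤ 5 / 2 * (ρ * τ)) (hU : 0 ≤ U) (hΛ : 0 ≤ Λ) (hW : 0 ≤ W) (hG : 0 ≤ G)
    (hN : N ≤ κ * U + ρ * W + γ * P * G) (hS : -(2 * K * U) ≤ S) :
    β * (-(p * e / t) / 2 * S) + K * p / t * (β * a * U + κ * N + κ * (1 - η) * U + Λ)
      ≤ K * p * (5 / 2 * c + 5 / 2 * a + (κ ^ 2 + 3 / 2 * κ + 1) / γ + κ + κ * γ) / t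
        * (ρ * τ * U + ρ * τ * Λ + ρ * W + P * G) := by
  obtain ⟨hη1, hη2⟩ := abs_le.1 hη
  have hρτ : 0 < ρ * τ := hγ.trans_le hγρ
  have hc : 0 ≤ c := he.trans hec
  have h1 : β * (-(p * e / t) / 2 * S) ≤ K * p / t * (5 / 2 * c * (ρ * τ * U)) :=
    calc β * (-(p * e / t) / 2 * S) = β * (p * e / t / 2) * (-S) := by ring
      _ ≤ β * (p * e / t / 2) * (2 * K * U) := by gcongr; linarith
      _ = K * p / t * (β * e * U) := by ring
      _ ≤ K * p / t * (5 / 2 * (ρ * τ) * c * U) := by gcongr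
      _ = _ := by ring
  have h2 : β * a * U ≤ 5 / 2 * a * (ρ * τ * U) :=
    calc β * a * U ≤ 5 / 2 * (ρ * τ) * a * U := by gcongr
      _ = _ := by ring
  -- The lower bound on the mass enters here: terms without a weight are charged to those carrying
  -- ρτ.
  have hone : 1 ≤ ρ * τ / γ := (one_le_div hγ).2 hγρ
  have h3 : κ * N ≤ κ ^ 2 / γ * (ρ * τ * U) + κ * (ρ * W) + κ * γ * (P * G) :=
    calc κ * N ≤ κ * (κ * U + ρ * W + γ * P * G) := by gcongr
      _ = κ ^ 2 * (1 * U) + κ * (ρ * W) + κ * γ * (P * G) := by ring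
      _ ≤ κ ^ 2 * (ρ * τ / γ * U) + κ * (ρ * W) + κ * γ * (P * G) := by gcongr
      _ = _ := by ring
  have h4 : κ * (1 - η) * U ≤ 3 / 2 * κ / γ * (ρ * τ * U) :=
    calc κ * (1 - η) * U ≤ κ * (3 / 2) * U := by gcongr; linarith
      _ = 3 / 2 * κ * (1 * U) := by ring
      _ ≤ 3 / 2 * κ * (ρ * τ / γ * U) := by gcongr
      _ = _ := by ring
  have h5 : Λ ≤ 1 / γ * (ρ * τ * Λ) :=
    calc Λ = 1 * Λ := (one_mul _).symm
      _ ≤ ρ * τ / γ * Λ := by gcongr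
      _ = _ := by ring
  have h6 : 5 / 2 * c * (ρ * τ * U) + (β * a * U + κ * N + κ * (1 - η) * U + Λ)
      ≤ (5 / 2 * c + 5 / 2 * a + (κ ^ 2 + 3 / 2 * κ + 1) / γ + κ + κ * γ)
        * (ρ * τ * U + ρ * τ * Λ + ρ * W + P * G) := by
    set u := ρ * τ * U
    set v := ρ * τ * Λ
    set w := ρ * W
    set g := P * G
    have u0 : 0 ≤ u := by positivity
    have v0 : 0 ≤ v := by positivity
    have w0 : 0 ≤ w := by positivity
    have g0 : 0 ≤ g := by positivity
    have e1 : (κ ^ 2 + 3 / 2 * κ + 1) / γ = κ ^ 2 / γ + 3 / 2 * κ / γ + 1 / γ := by ring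
    rw [e1]
    have k1 : 0 ≤ κ ^ 2 / γ := by positivity
    have k2 : 0 ≤ 3 / 2 * κ / γ := by positivity
    have k3 : 0 ≤ 1 / γ := by positivity
    have k4 : 0 ≤ κ * γ := by positivity
    have r1 : 0 ≤ (5 / 2 * c + 5 / 2 * a) * (v + w + g) := by positivity
    have r2 : 0 ≤ κ ^ 2 / γ * (v + w + g) := by positivity
    have r3 : 0 ≤ 3 / 2 * κ / γ * (v + w + g) := by positivity
    have r4 : 0 ≤ 1 / γ * (u + w + g) := by positivity
    have r5 : 0 ≤ κ * (u + v + g) := by positivity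
    have r6 : 0 ≤ κ * γ * (u + v + w) := by positivity
    linarith only [h2, h3, h4, h5, r1, r2, r3, r4, r5, r6]
  have h7 := mul_le_mul_of_nonneg_left h6 (show 0 ≤ K * p / t by positivity)
  calc _ ≤ K * p / t * (5 / 2 * c * (ρ * τ * U))
        + K * p / t * (β * a * U + κ * N + κ * (1 - η) * U + Λ) := by linarith only [h1]
    _ = K * p / t * (5 / 2 * c * (ρ * τ * U) + (β * a * U + κ * N + κ * (1 - η) * U + Λ)) := by
        ring
    _ ≤ _ := h7
    _ = _ := by ring

end Coefficients

/-! ### Differential equations satisfied by the momentum and the dual variable -/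

section Flow

theorem IsMonotoneOperator.continuousAt_path {H : Type*} [NormedAddCommGroup H]
    [InnerProductSpace ℝ H] {T : H → H} (hT : IsMonotoneOperator T) {ε : ℝ → ℝ} {z : ℝ → H}
    {t : ℝ} (hε : ContinuousAt ε t) (hpos : 0 < ε t) (hz : ∀ᶠ u in 𝓝 t, T (z u) + ε u • z u = 0) :
    ContinuousAt z t := by
  have hlim : Tendsto (fun u => |ε u - ε t| * ‖z t‖ / ε u) (𝓝 t) (𝓝 0) := by
    have h1 : Tendsto (fun u => |ε u - ε t| * ‖z t‖ / ε u) (𝓝 t)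
        (𝓝 (|ε t - ε t| * ‖z t‖ / ε t)) :=
      (((hε.tendsto.sub_const (ε t)).abs).mul_const ‖z t‖).div hε.tendsto hpos.ne'
    simpa using h1
  rw [ContinuousAt, tendsto_iff_norm_sub_tendsto_zero]
  refine squeeze_zero' (Eventually.of_forall fun u => norm_nonneg _) ?_ hlim
  filter_upwards [hz, hε.eventually (lt_mem_nhds hpos)] with u hu hu0
  rw [le_div_iff₀ hu0, mul_comm, norm_sub_rev]
  exact hT.mul_norm_sub_le hz.self_of_nhds hu

variable {X Y : Type*} [NormedAddCommGroup X] [InnerProductSpace ℝ X] [CompleteSpace X]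
  [NormedAddCommGroup Y] [InnerProductSpace ℝ Y] [CompleteSpace Y]
  {f : X → ℝ} {A : X →L[ℝ] Y} {b : Y} {c p α γ q s t₀ : ℝ} {m m₁ : ℝ → ℝ}
  {x : ℝ → X} {lam : ℝ → Y}

theorem gradX_eq (hd : Differentiable ℝ f) (t : ℝ) (u : X) (μ : Y) :
    gradX f A b c p t u μ = gradient f u + A.adjoint μ + (c / t ^ p) • u := by
  unfold gradX
  rw [augLagrangian_eq_regLagrangian]
  exact (hasGradientAt_regLagrangian_fst hd _ u μ).gradient

omit [CompleteSpace X] in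
theorem gradDual_eq (t : ℝ) (u : X) (μ : Y) :
    gradDual f A b c p t u μ = A u - b - (c / t ^ p) • μ := by
  unfold gradDual
  rw [augLagrangian_eq_regLagrangian]
  exact (hasGradientAt_regLagrangian_snd _ u μ).gradient

theorem DifferentiableOn.hasDerivAt_timeDeriv {E : Type*} [NormedAddCommGroup E]
    [NormedSpace ℝ E] {u : ℝ → E} (hu : DifferentiableOn ℝ u (Ici t₀)) {t : ℝ} (ht : t₀ < t) :
    HasDerivAt u (timeDeriv t₀ u t) t :=
  (hu t ht.le).hasDerivWithinAt.hasDerivAt (Ici_mem_nhds ht)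

/-- The primal equation times t^q, read as a total derivative. The derivative of γ t^q falls on the
gradient and lowers its coefficient from t^(q+s) to δ. -/
theorem IsGlobalSolution.hasDerivAt_momentum
    (h : IsGlobalSolution f A b c p α γ q s t₀ m x lam) {t : ℝ} (ht : t₀ < t) (ht0 : 0 < t)
    (hm : HasDerivAt m (m₁ t) t) :
    HasDerivAt (fun u => (u ^ q * m u) • timeDeriv t₀ x u
        + (γ * u ^ q) • gradX f A b c p u (x u) (lam u))
      ((massRate q m m₁ t - 1 - (α - 1)) • timeDeriv t₀ x t
        - dampingCoeff γ q s t • gradX f A b c p t (x t) (lam t)) t := by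
  have h1 := (hasDerivAt_rpow_mul (q := q) ht0 hm).smul
    (h.differentiable_velocity.hasDerivAt_timeDeriv ht)
  have h2 := ((Real.hasDerivAt_rpow_const (p := q) (Or.inl ht0.ne')).const_mul γ).smul
    (h.differentiable_grad.hasDerivAt_timeDeriv ht)
  refine (h1.add h2).congr_deriv ?_
  have heq := h.primal_eq t ht.le
  have hP : 0 < t ^ q := Real.rpow_pos_of_pos ht0 q
  have e1 : α = t ^ q * (α / t ^ q) := by field_simp
  have e2 : t ^ (q + s) = t ^ q * t ^ s := Real.rpow_add ht0 q s
  unfold dampingCoeff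
  rw [e2]
  generalize α / t ^ q = a at *
  rw [e1]
  have h3 := congrArg (fun y => t ^ q • y) heq
  simp only [smul_zero] at h3
  rw [← sub_eq_zero, ← h3]
  simp only [massRate]
  module

/-- This identity explains the form of θ(t): it makes the coefficient of A x' in the dual equation
equal to the weight of the gap. -/
theorem extrapolation_mul (hα : 1 < α) {t : ℝ} (ht : 0 < t) (hδ : 0 < dampingCoeff γ q s t) :
    (α - 1) * dampingCoeff γ q s t * extrapolation α γ q s t₀ m t
      = gapWeight γ q s m (timeDeriv t₀ m) t := by
  have hα' : 0 < α - 1 := by linarith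
  have e1 : (α - 1) * dampingCoeff γ q s t ≠ 0 := by positivity
  unfold extrapolation
  rw [show (α - 1) * (t ^ (q + s) - γ * q * t ^ (q - 1)) = (α - 1) * dampingCoeff γ q s t from rfl,
    mul_div_cancel₀ _ e1]
  unfold gapWeight dampingCoeff massRate
  have f1 : t ^ (2 * q + s) = t ^ q * t ^ (q + s) := by
    rw [← Real.rpow_add ht]; congr 1; ring
  have f2 : t ^ (2 * q - 1) = t ^ q * t ^ (q - 1) := by
    rw [← Real.rpow_add ht]; congr 1; ring
  have f3 : t ^ (2 * q) = t ^ q * t ^ q := by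
    rw [← Real.rpow_add ht]; congr 1; ring
  rw [f1, f2, f3]
  ring

theorem IsGlobalSolution.hasDerivAt_dual
    (h : IsGlobalSolution f A b c p α γ q s t₀ m x lam) (hα : 1 < α) {t : ℝ} (ht : t₀ < t)
    (ht0 : 0 < t) (hδ : 0 < dampingCoeff γ q s t) :
    HasDerivAt lam (((α - 1) * dampingCoeff γ q s t) • (A (x t) - b - (c / t ^ p) • lam t)
      + gapWeight γ q s m (timeDeriv t₀ m) t • A (timeDeriv t₀ x t)) t := by
  refine (h.differentiable_dual.hasDerivAt_timeDeriv ht).congr_deriv ?_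
  have heq := sub_eq_zero.1 (h.dual_eq t ht.le)
  rw [heq, ← extrapolation_mul (t₀ := t₀) hα ht0 hδ, gradDual_eq, map_add, map_smul]
  unfold dampingCoeff
  module

end Flow

/-! ### The energy estimate along the trajectory -/

section Rate

theorem exists_pos_mul_le {A₁ A₂ A₃ A₄ A₅ B₁ B₂ B₃ B₄ B₅ : ℝ} (h₁ : 0 < B₁) (h₂ : 0 < B₂)
    (h₃ : 0 < B₃) (h₄ : 0 < B₄) (h₅ : 0 < B₅) :
    ∃ θ : ℝ, 0 < θ ∧ θ * A₁ ≤ B₁ ∧ θ * A₂ ≤ B₂ ∧ θ * A₃ ≤ B₃ ∧ θ * A₄ ≤ B₄ ∧ θ * A₅ ≤ B₅ := by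
  have key : ∀ {A B : ℝ}, 0 < B → ∀ᶠ θ in 𝓝[>] (0 : ℝ), θ * A ≤ B := by
    intro A B hB
    have h : Tendsto (fun θ : ℝ => θ * A) (𝓝[>] 0) (𝓝 (0 * A)) :=
      (tendsto_id.mul_const A).mono_left nhdsWithin_le_nhds
    rw [zero_mul] at h
    exact (h.eventually (gt_mem_nhds hB)).mono fun _ h => h.le
  exact (eventually_mem_nhdsWithin.and ((key h₁).and ((key h₂).and ((key h₃).and
    ((key h₄).and (key h₅)))))).exists

theorem hasDerivAt_div_rpow {c p t : ℝ} (ht : 0 < t) :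
    HasDerivAt (fun u => c / u ^ p) (-(p * (c / t ^ p) / t)) t := by
  have h := (Real.hasDerivAt_rpow_const (p := -p) (Or.inl ht.ne')).const_mul c
  have h2 : HasDerivAt (fun u => c / u ^ p) (c * (-p * t ^ (-p - 1))) t := by
    refine h.congr_of_eventuallyEq ?_
    filter_upwards [lt_mem_nhds ht] with u hu
    rw [Real.rpow_neg hu.le, div_eq_mul_inv]
  refine h2.congr_deriv ?_
  rw [Real.rpow_sub ht, Real.rpow_neg ht.le, Real.rpow_one]
  field_simp

/-- The remainder in the energy inequality is controlled by the target rate. -/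
theorem remainder_le {c k p q r s σ a₁ a₂ t μ : ℝ} (hc : 0 < c) (ha₁ : 0 ≤ a₁) (ha₂ : 0 ≤ a₂)
    (ht : 1 ≤ t) (hμ : 0 < μ) (hμk : t ^ q * μ ≤ k) (h₁ : 2 * q + s + p - 2 ≤ σ - r)
    (h₂ : q - 2 ≤ σ - r) :
    a₁ * (t ^ (q + s) * (t ^ q * μ) ^ 2 / (c / t ^ p * t ^ 2)) + a₂ * (t ^ q * μ / t ^ 2)
      ≤ (a₁ * (k / c) + a₂) * (t ^ (-r) * (μ * t ^ σ)) := by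
  have ht0 : 0 < t := by linarith
  have hk : 0 < k := (mul_pos (Real.rpow_pos_of_pos ht0 q) hμ).trans_le hμk
  have e0 : t ^ (-r) * (μ * t ^ σ) = μ * t ^ (σ - r) := by
    rw [show σ - r = -r + σ by ring, Real.rpow_add ht0]; ring
  have b1 : t ^ (q + s) * (t ^ q * μ) ^ 2 / (c / t ^ p * t ^ 2) ≤ k / c * (μ * t ^ (σ - r)) := by
    -- One of the two factors t^q μ is bounded by k; the other keeps the mass in the rate.
    have e1 : t ^ (q + s) * (t ^ q * μ) ^ 2 / (c / t ^ p * t ^ 2)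
        = (t ^ q * μ) / c * (μ * t ^ (2 * q + s + p - 2)) := by
      rw [show 2 * q + s + p - 2 = (q + s) + q + p - 2 by ring, Real.rpow_sub ht0,
        Real.rpow_add ht0 _ p, Real.rpow_add ht0 _ q, Real.rpow_ofNat]
      field_simp
    rw [e1]
    gcongr
  have b2 : t ^ q * μ / t ^ 2 ≤ μ * t ^ (σ - r) := by
    have e1 : t ^ q * μ / t ^ 2 = μ * t ^ (q - 2) := by
      rw [Real.rpow_sub ht0, Real.rpow_ofNat]; ring
    rw [e1]
    gcongr
  rw [e0]
  have c1 := mul_le_mul_of_nonneg_left b1 ha₁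
  have c2 := mul_le_mul_of_nonneg_left b2 ha₂
  linarith

variable {X Y : Type*} [NormedAddCommGroup X] [InnerProductSpace ℝ X] [CompleteSpace X]
  [NormedAddCommGroup Y] [InnerProductSpace ℝ Y] [CompleteSpace Y]
  {f : X → ℝ} {A : X →L[ℝ] Y} {b : Y} {c p α γ q s t₀ : ℝ} {m : ℝ → ℝ}
  {x : ℝ → X} {lam : ℝ → Y}

set_option maxHeartbeats 1000000 in
/-- The energy inequality at a single time: the upper bound for the Dini derivative. -/
theorem energy_dini_le (hf : ConvexOn ℝ univ f) (hd : Differentiable ℝ f)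
    {κ θ k C₁ K r σ t : ℝ} {m₁ m₂ : ℝ → ℝ} (hκ : 0 < κ) (hγ : 0 < γ) (hc : 0 < c) (hp : 0 < p)
    (hK : 0 ≤ K)
    (hθ : 0 < θ) (hθ1 : θ * (10 * k) ≤ κ) (hθ2 : θ * (12 * κ + 6) ≤ c) (hθ3 : θ * (6 * k) ≤ 1)
    (hθ4 : θ * (6 * γ) ≤ 1) (hθ5 : θ * 2 ≤ κ * c) (hq : 0 < q)
    (hr0 : 0 ≤ r) (hpr : p - q - s ≤ r) (h₁ : 2 * q + s + p - 2 ≤ σ - r) (h₂ : q - 2 ≤ σ - r)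
    (hB : CoefficientBounds κ γ q s k C₁ m m₁ m₂ t)
    (hC₁ : 8 * C₁ ≤ c * t ^ (q + s - p + 2))
    {u w g V V' a : X} {μ μ' l : Y} (hcrit : IsCritical f A b (c / t ^ p) a l)
    (haK : ‖a‖ ≤ K)
    (hg : g = gradient f u + A.adjoint μ + (c / t ^ p) • u)
    (hV : V = (t ^ q * m t) • w + (γ * t ^ q) • g)
    (hV' : V' = (massRate q m m₁ t - 1 - κ) • w - dampingCoeff γ q s t • g)
    (hμ' : μ' = (κ * dampingCoeff γ q s t) • (A u - b - (c / t ^ p) • μ)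
      + gapWeight γ q s m m₁ t • A w) {C : ℝ}
    (hC : C = K * p * (5 / 2 * c + 5 / 2 * ‖A‖ + (κ ^ 2 + 3 / 2 * κ + 1) / γ + κ + κ * γ)) :
    (gapWeightDeriv γ q s m m₁ m₂ t * primalGap f A (c / t ^ p) u a l
        + gapWeight γ q s m m₁ t * (inner ℝ (gradient f u + A.adjoint l + (c / t ^ p) • u) w
          + -(p * (c / t ^ p) / t) / 2 * (‖u‖ ^ 2 - ‖a‖ ^ 2))
        + inner ℝ (κ • (u - a) + V) (κ • w + V')
        + (κ * (1 - massRate q m m₁ t) * inner ℝ (u - a) w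
          - κ * massRateDeriv q m m₁ m₂ t / 2 * ‖u - a‖ ^ 2)
        + inner ℝ (μ - l) μ')
      + K * |-(p * (c / t ^ p) / t)| / (c / t ^ p) * (gapWeight γ q s m m₁ t * ‖A‖ * ‖u - a‖
        + κ * ‖κ • (u - a) + V‖ + κ * (1 - massRate q m m₁ t) * ‖u - a‖ + ‖μ - l‖)
      ≤ -(θ * t ^ (-r)) * energy f A κ (gapWeight γ q s m m₁ t) (massRate q m m₁ t) (c / t ^ p)
          u V μ a l
        + (8 * C ^ 2 / κ * (k / c) + (C ^ 2 + C ^ 2 / γ ^ 2)) * (t ^ (-r) * (m t * t ^ σ)) := by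
  have ht : 0 < t := by linarith [hB.one_le]
  have hP : 0 < t ^ q := Real.rpow_pos_of_pos ht q
  have hτ : 0 < t ^ (q + s) := Real.rpow_pos_of_pos ht _
  have htp : 0 < t ^ p := Real.rpow_pos_of_pos ht p
  have he : 0 < c / t ^ p := div_pos hc htp
  have hδ0 : 0 < dampingCoeff γ q s t := by linarith [hB.le_damping]
  have hτe : t ^ (q + s) * (c / t ^ p) = c * t ^ (q + s - p) := by
    rw [Real.rpow_sub ht]; field_simp
  have hze : c * t ^ (-r) ≤ t ^ (q + s) * (c / t ^ p) := by
    rw [hτe]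
    exact mul_le_mul_of_nonneg_left
      (Real.rpow_le_rpow_of_exponent_le hB.one_le (by linarith)) hc.le
  -- The left side is O(t^(-2)), the right side c t^(q+s-p); `hC₁` makes t large enough to compare
  -- them.
  have hη' : 8 * |massRateDeriv q m m₁ m₂ t| ≤ t ^ (q + s) * (c / t ^ p) := by
    refine le_of_mul_le_mul_left ?_ (pow_pos ht 2)
    have e1 : t ^ 2 * (t ^ (q + s) * (c / t ^ p)) = c * t ^ (q + s - p + 2) := by
      rw [hτe, Real.rpow_add ht _ 2, Real.rpow_ofNat]; ring
    rw [e1]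
    linarith [hB.rateDeriv_le]
  have hγρ : γ ≤ t ^ q * m t * t ^ (q + s) :=
    le_trans (le_mul_of_one_le_right hγ.le (Real.one_le_rpow hB.one_le hq.le)) hB.le_mass
  have hD : 0 ≤ primalGap f A (c / t ^ p) u a l :=
    le_trans (by positivity) (hcrit.primalGap_ge hf hd u)
  have hN : ‖κ • (u - a) + V‖
      ≤ κ * ‖u - a‖ + t ^ q * m t * ‖w‖ + γ * t ^ q * ‖g‖ := by
    rw [hV]
    refine (norm_add_le _ _).trans ?_
    have n1 : ‖κ • (u - a)‖ = κ * ‖u - a‖ := by rw [norm_smul, Real.norm_of_nonneg hκ.le]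
    have n2 : ‖(t ^ q * m t) • w + (γ * t ^ q) • g‖
        ≤ t ^ q * m t * ‖w‖ + γ * t ^ q * ‖g‖ := by
      refine (norm_add_le _ _).trans ?_
      rw [norm_smul, norm_smul, Real.norm_of_nonneg hB.mass_pos.le,
        Real.norm_of_nonneg (by positivity)]
    linarith
  have hS : -(2 * K * ‖u - a‖) ≤ ‖u‖ ^ 2 - ‖a‖ ^ 2 := by
    have e1 : ‖u‖ ^ 2 = ‖a‖ ^ 2 + 2 * inner ℝ a (u - a) + ‖u - a‖ ^ 2 := by
      rw [← norm_add_sq_real, add_sub_cancel]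
    have e2 : -(K * ‖u - a‖) ≤ inner ℝ a (u - a) := by
      have := neg_le_of_abs_le (abs_real_inner_le_norm a (u - a))
      have h3 : ‖a‖ * ‖u - a‖ ≤ K * ‖u - a‖ := by gcongr
      linarith
    have e3 := sq_nonneg ‖u - a‖
    linarith
  have hec : c / t ^ p ≤ c := div_le_self hc.le (Real.one_le_rpow hB.one_le hp.le)
  have hfor := forcing_le (c := c) (N := ‖κ • (u - a) + V‖) hκ.le hγ hp.le hK (norm_nonneg A) ht
    he.le hec hγρ hB.mass_pos.le hP.le hB.rate_le hB.weight_nonneg hB.weight_le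
    (norm_nonneg (u - a)) (norm_nonneg (μ - l)) (norm_nonneg w) (norm_nonneg g) hN hS
  rw [← hC] at hfor
  have hdamp := damping_estimate hκ hγ hθ hθ1 hθ2 hθ3 hθ4 hθ5 ht hτ hB.mass_pos
    hB.mass_le hP hB.rpow_le he (Real.rpow_pos_of_pos ht (-r))
    (Real.rpow_le_one_of_one_le_of_nonpos hB.one_le (by linarith)) hze hB.le_mass hB.le_damping
    hB.rate_le hB.weightDeriv_le hη' hB.weight_le hD (norm_nonneg _) hN hfor
  have hder := energy_deriv_le (β' := gapWeightDeriv γ q s m m₁ m₂ t)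
    (η' := massRateDeriv q m m₁ m₂ t) (ε' := -(p * (c / t ^ p) / t)) hf hd hcrit
    (mul_pos hκ hδ0).le (show gapWeight γ q s m m₁ t = _ from rfl) hg hV hV' hμ'
  have hmt : 0 < m t := pos_of_mul_pos_right hB.mass_pos hP.le
  have hrem := remainder_le (a₁ := 8 * C ^ 2 / κ) (a₂ := C ^ 2 + C ^ 2 / γ ^ 2) hc
    (by positivity) (by positivity) hB.one_le hmt hB.mass_le h₁ h₂
  have habs : K * |-(p * (c / t ^ p) / t)| / (c / t ^ p) = K * p / t := by
    rw [abs_neg, abs_of_pos (by positivity)]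
    field_simp
  rw [habs]
  unfold energy
  linarith only [hder, hdamp, hrem]

/-- Gathers the Dini inequality, the fencing argument and the coercivity of the energy. The exponent
r is the decay rate that the damping t^(q+s) · c / t^p allows, and σ the rate compatible with the
remainder. -/
theorem exists_sq_norm_le (hf : ConvexOn ℝ univ f) (hd : Differentiable ℝ f)
    (hc : 0 < c) (hα : 1 < α) (hγ : 0 < γ) (hq0 : 0 < q) (hq1 : q < 1) (hs : 0 < s)
    (ht₀ : 0 < t₀) (hm : IsMass t₀ m) (hm1 : MassBounds γ q s m) (hm2 : MassDerivBounds t₀ m)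
    (hp0 : 0 < p) (hp1 : p < 1) (hsol : IsGlobalSolution f A b c p α γ q s t₀ m x lam)
    {r σ : ℝ} (hr0 : 0 ≤ r) (hr1 : r < 1) (hpr : p - q - s ≤ r)
    (h₁ : 2 * q + s + p - 2 ≤ σ - r) (h₂ : q - 2 ≤ σ - r) {xt : ℝ → X} {lt : ℝ → Y}
    (hcrit : ∀ t ≥ t₀, IsCritical f A b (c / t ^ p) (xt t) (lt t)) {K : ℝ}
    (hK : ∀ t ≥ t₀, ‖WithLp.toLp 2 (xt t, lt t)‖ ≤ K) :
    ∃ M, ∀ᶠ t in atTop, ‖x t - xt t‖ ^ 2 + ‖lam t - lt t‖ ^ 2 ≤ M * (m t * t ^ σ) := by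
  obtain ⟨k₁, hk₁, hmb⟩ := hm1
  obtain ⟨k₂, hk₂, hmd⟩ := hm2
  set κ := α - 1 with hκdef
  have hκ : 0 < κ := by linarith
  have hK0 : 0 ≤ K := (norm_nonneg _).trans (hK t₀ le_rfl)
  set m₁ := timeDeriv t₀ m with hm₁
  set m₂ := timeDeriv t₀ m₁ with hm₂
  have hB := eventually_coefficientBounds (m := m) (m₁ := m₁) (m₂ := m₂) hκ hγ hq0 hq1 hs hk₁ hk₂
    ((eventually_ge_atTop t₀).mono fun t ht => hm.pos t ht) (hmb.mono fun t h => h.1)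
    (hmb.mono fun t h => h.2) (hmd.mono fun t h => h.2.1) (hmd.mono fun t h => h.2.2)
  set C₁ := (1 + 3 * k₂) * k₁ with hC₁
  have hlarge : ∀ᶠ t : ℝ in atTop, 8 * C₁ ≤ c * t ^ (q + s - p + 2) := by
    have h := (tendsto_rpow_atTop (show 0 < q + s - p + 2 by linarith)).eventually_ge_atTop
      (8 * C₁ / c)
    filter_upwards [h] with t ht
    rw [div_le_iff₀ hc] at ht
    linarith
  obtain ⟨T, hT⟩ := eventually_atTop.1 (((hB.and hlarge).and hmd).and (eventually_gt_atTop t₀))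
  have hTt₀ : t₀ < T := (hT T le_rfl).2
  have hT0 : 0 < T := ht₀.trans hTt₀
  obtain ⟨θ, hθ, hθ1, hθ2, hθ3, hθ4, hθ5⟩ := exists_pos_mul_le (A₁ := 10 * k₁)
    (A₂ := 12 * κ + 6) (A₃ := 6 * k₁) (A₄ := 6 * γ) (A₅ := 2) hκ hc one_pos one_pos
    (mul_pos hκ hc)
  set w := timeDeriv t₀ x with hw
  set g : ℝ → X := fun t => gradX f A b c p t (x t) (lam t) with hg
  set V : ℝ → X := fun u => (u ^ q * m u) • w u + (γ * u ^ q) • g u with hVdef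
  set E : ℝ → ℝ := fun t => energy f A κ (gapWeight γ q s m m₁ t) (massRate q m m₁ t) (c / t ^ p)
    (x t) (V t) (lam t) (xt t) (lt t) with hE
  have hdm : ∀ t ≥ T, HasDerivAt m (m₁ t) t := fun t ht =>
    hm.differentiable.hasDerivAt_timeDeriv (hTt₀.trans_le ht)
  have hdm₁ : ∀ t ≥ T, HasDerivAt m₁ (m₂ t) t := fun t ht =>
    (hT t ht).1.2.1.hasDerivWithinAt.hasDerivAt (Ici_mem_nhds (hTt₀.trans_le ht))
  have hdx : ∀ t ≥ T, HasDerivAt x (w t) t := fun t ht =>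
    hsol.differentiable_x.hasDerivAt_timeDeriv (hTt₀.trans_le ht)
  have hdV : ∀ t ≥ T, HasDerivAt V ((massRate q m m₁ t - 1 - κ) • w t
      - dampingCoeff γ q s t • g t) t := fun t ht =>
    hsol.hasDerivAt_momentum (hTt₀.trans_le ht) (hT0.trans_le ht) (hdm t ht)
  have hδ : ∀ t ≥ T, 0 < dampingCoeff γ q s t := fun t ht => by
    have h1 := (hT t ht).1.1.1.le_damping
    have h2 := Real.rpow_pos_of_pos (hT0.trans_le ht) (q + s)
    linarith
  have hdlam : ∀ t ≥ T, HasDerivAt lam ((κ * dampingCoeff γ q s t) •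
      (A (x t) - b - (c / t ^ p) • lam t) + gapWeight γ q s m m₁ t • A (w t)) t := fun t ht =>
    hsol.hasDerivAt_dual hα (hTt₀.trans_le ht) (hT0.trans_le ht) (hδ t ht)
  have hdη : ∀ t ≥ T, HasDerivAt (massRate q m m₁) (massRateDeriv q m m₁ m₂ t) t := fun t ht =>
    hasDerivAt_massRate (hT0.trans_le ht) (hdm t ht) (hdm₁ t ht)
  have hdβ : ∀ t ≥ T, HasDerivAt (gapWeight γ q s m m₁) (gapWeightDeriv γ q s m m₁ m₂ t) t :=
    fun t ht => hasDerivAt_gapWeight (hT0.trans_le ht) (hdm t ht) (hdm₁ t ht)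
  have hdε : ∀ t ≥ T, HasDerivAt (fun u => c / u ^ p) (-(p * (c / t ^ p) / t)) t := fun t ht =>
    hasDerivAt_div_rpow (hT0.trans_le ht)
  have hεpos : ∀ t ≥ T, 0 < c / t ^ p := fun t ht =>
    div_pos hc (Real.rpow_pos_of_pos (hT0.trans_le ht) p)
  have hzt : ∀ t ≥ T, ContinuousAt (fun u => WithLp.toLp 2 (xt u, lt u)) t := by
    intro t ht
    refine (isMonotoneOperator_saddleOperator (A := A) (b := b) hf hd).continuousAt_path
      (hdε t ht).continuousAt (hεpos t ht) ?_
    filter_upwards [Ici_mem_nhds (hTt₀.trans_le ht)] with u hu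
    exact saddleOperator_add_smul_eq_zero_iff.2 (hcrit u hu)
  have hxt : ∀ t ≥ T, ContinuousAt xt t := fun t ht =>
    (WithLp.continuous_fst 2 X Y).continuousAt.comp (hzt t ht)
  have hlt : ∀ t ≥ T, ContinuousAt lt t := fun t ht =>
    (WithLp.continuous_snd 2 X Y).continuousAt.comp (hzt t ht)
  have hEcont : ContinuousOn E (Ici T) := by
    intro t ht
    refine ContinuousAt.continuousWithinAt ?_
    have c1 := (hdβ t ht).continuousAt
    have c2 := (hdη t ht).continuousAt
    have c3 := (hdε t ht).continuousAt
    have c4 := (hdx t ht).continuousAt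
    have c5 := (hdV t ht).continuousAt
    have c6 := (hdlam t ht).continuousAt
    have c7 := hxt t ht
    have c8 := hlt t ht
    have c9 : ContinuousAt (fun u => f (x u)) t := hd.continuous.continuousAt.comp c4
    have c10 : ContinuousAt (fun u => f (xt u)) t := hd.continuous.continuousAt.comp c7
    have c11 := c4.sub c7
    have c12 := c8.inner (𝕜 := ℝ) (A.continuous.continuousAt.comp c11)
    exact (((c1.mul (((c9.sub c10).add c12).add ((c3.div_const 2).mul
      ((c4.norm.pow 2).sub (c7.norm.pow 2))))).add
      (continuousAt_const.mul (((c11.const_smul κ).add c5).norm.pow 2))).add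
      (((continuousAt_const.mul (continuousAt_const.sub c2)).div_const 2).mul
      (c11.norm.pow 2))).add (continuousAt_const.mul ((c6.sub c8).norm.pow 2))
  set C := K * p * (5 / 2 * c + 5 / 2 * ‖A‖ + (κ ^ 2 + 3 / 2 * κ + 1) / γ + κ + κ * γ) with hC
  set C₂ := 8 * C ^ 2 / κ * (k₁ / c) + (C ^ 2 + C ^ 2 / γ ^ 2) with hC₂
  have hmpos : ∀ t ≥ T, 0 < m t := fun t ht => hm.pos t (hTt₀.le.trans ht)
  have hdG : ∀ t ≥ T, HasDerivAt (fun t => m t * t ^ σ)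
      (m₁ t * t ^ σ + m t * (σ * t ^ (σ - 1))) t := fun t ht =>
    (hdm t ht).mul (Real.hasDerivAt_rpow_const (Or.inl (hT0.trans_le ht).ne'))
  have hbar : ∃ M, ∀ᶠ t in atTop, E t ≤ M * (m t * t ^ σ) := by
    refine exists_le_mul_of_slope_lt (E := E) (G := fun t => m t * t ^ σ)
      (G' := fun t => m₁ t * t ^ σ + m t * (σ * t ^ (σ - 1))) (T := T) (θ := θ) (C := C₂)
      (C' := k₂ + |σ|) (r := r) hT0 hθ hr1 hEcont ?_ ?_ hdG ?_
    · intro t ht y hy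
      have hBt := (hT t ht).1.1.1
      have hcr := hcrit t (hTt₀.le.trans ht)
      have hfrozen := hasDerivAt_energy (A := A) (κ := κ) hd (hdβ t ht) (hdη t ht) (hdε t ht)
        (hdx t ht) (hdV t ht) (hdlam t ht) (xt t) (lt t)
      have hKt := hK t (hTt₀.le.trans ht)
      have hdini := energy_dini_le (k := k₁) (C₁ := C₁) (m₂ := m₂) hf hd hκ hγ hc hp0 hK0 hθ hθ1 hθ2
        hθ3 hθ4 hθ5 hq0 hr0 hpr h₁ h₂ hBt (hT t ht).1.1.2 hcr
        ((WithLp.norm_fst_le (p := 2) X (WithLp.toLp 2 (xt t, lt t))).trans hKt)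
        (gradX_eq hd t (x t) (lam t)) (show V t = _ from rfl) rfl rfl hC
      exact eventually_slope_energy_lt (A := A) (b := b) hf hd hκ.le (hdε t ht)
        (hdβ t ht).continuousAt (hdη t ht).continuousAt (hdx t ht).continuousAt
        (hdV t ht).continuousAt (hdlam t ht).continuousAt hfrozen
        (fun u hu => hεpos u (ht.le.trans hu)) (fun u hu => hcrit u (hTt₀.le.trans (ht.le.trans hu)))
        (by
          filter_upwards [self_mem_nhdsWithin] with u hu
          exact (hT u (le_trans ht (le_of_lt hu))).1.1.1.weight_nonneg)
        (by
          filter_upwards [self_mem_nhdsWithin] with u hu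
          have := (abs_le.1 (hT u (le_trans ht (le_of_lt hu))).1.1.1.rate_le).2
          linarith)
        hKt (hdini.trans_lt hy)
    · intro t ht
      exact mul_pos (hmpos t ht) (Real.rpow_pos_of_pos (hT0.trans_le ht) σ)
    · intro t ht
      have ht0 := hT0.trans_le ht
      have hσ := Real.rpow_pos_of_pos ht0 σ
      have hmt := hmpos t ht
      have e : t ^ (σ - 1) = t ^ σ / t := by rw [Real.rpow_sub ht0, Real.rpow_one]
      have h1 := (hT t ht).1.2.2.1
      calc t * |m₁ t * t ^ σ + m t * (σ * t ^ (σ - 1))|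
          ≤ t * (|m₁ t * t ^ σ| + |m t * (σ * t ^ (σ - 1))|) := by
            gcongr; exact abs_add_le _ _
        _ = t * |m₁ t| * t ^ σ + |σ| * (m t * t ^ σ) := by
            rw [abs_mul, abs_mul (m t), abs_mul σ, abs_of_pos hσ, abs_of_pos hmt, e,
              abs_of_pos (div_pos hσ ht0)]
            field_simp
        _ ≤ k₂ * m t * t ^ σ + |σ| * (m t * t ^ σ) := by gcongr
        _ = _ := by ring
  obtain ⟨M, hM⟩ := hbar
  refine ⟨(4 / κ + 2) * M, ?_⟩
  filter_upwards [hM, eventually_ge_atTop T] with t hMt ht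
  have hBt := (hT t ht).1.1.1
  have hD : 0 ≤ primalGap f A (c / t ^ p) (x t) (xt t) (lt t) :=
    le_trans (mul_nonneg (half_pos (hεpos t ht)).le (sq_nonneg _))
      ((hcrit t (hTt₀.le.trans ht)).primalGap_ge hf hd (x t))
  have hβD := mul_nonneg hBt.weight_nonneg hD
  have hrate := (abs_le.1 hBt.rate_le).2
  have hV0 := sq_nonneg ‖κ • (x t - xt t) + V t‖
  -- The gap and the momentum square are nonnegative, and η ≤ 1/2 leaves κ/4 in front of the primal
  -- distance.
  have hEt : κ / 4 * ‖x t - xt t‖ ^ 2 + 1 / 2 * ‖lam t - lt t‖ ^ 2 ≤ E t := by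
    have h1 : κ / 4 * ‖x t - xt t‖ ^ 2
        ≤ κ * (1 - massRate q m m₁ t) / 2 * ‖x t - xt t‖ ^ 2 := by
      refine mul_le_mul_of_nonneg_right ?_ (sq_nonneg _)
      have := mul_le_mul_of_nonneg_left hrate hκ.le
      linarith
    simp only [hE, energy]
    linarith
  have hU := sq_nonneg ‖x t - xt t‖
  have hΛ := sq_nonneg ‖lam t - lt t‖
  have h1 : ‖x t - xt t‖ ^ 2 ≤ 4 / κ * E t := by
    have e : ‖x t - xt t‖ ^ 2 = 4 / κ * (κ / 4 * ‖x t - xt t‖ ^ 2) := by field_simp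
    rw [e]
    refine mul_le_mul_of_nonneg_left ?_ (by positivity)
    linarith
  have h2 : ‖lam t - lt t‖ ^ 2 ≤ 2 * E t := by
    have : 0 ≤ κ / 4 * ‖x t - xt t‖ ^ 2 := by positivity
    linarith
  calc ‖x t - xt t‖ ^ 2 + ‖lam t - lt t‖ ^ 2 ≤ (4 / κ + 2) * E t := by linarith
    _ ≤ (4 / κ + 2) * (M * (m t * t ^ σ)) := by gcongr
    _ = _ := by ring

end Rate

/-! ### From distance to the path to convergence and rates -/

section Conclusion

variable {X Y : Type*} [NormedAddCommGroup X] [InnerProductSpace ℝ X] [CompleteSpace X]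
  [NormedAddCommGroup Y] [InnerProductSpace ℝ Y] [CompleteSpace Y]
  {f : X → ℝ} {A : X →L[ℝ] Y} {b : Y} {c p : ℝ} {m : ℝ → ℝ}
  {x : ℝ → X} {lam : ℝ → Y} {xt : ℝ → X} {lt : ℝ → Y} {xs : X} {ls : Y}

/-- The objective gap along the Tikhonov path. -/
theorem IsCritical.abs_sub_le (hf : ConvexOn ℝ univ f) (hd : Differentiable ℝ f) {ε K : ℝ}
    (hε : 0 ≤ ε) {a : X} {l : Y} (h : IsCritical f A b ε a l) (hs : IsCritical f A b 0 xs ls)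
    (ha : ‖a‖ ≤ K) (hl : ‖l‖ ≤ K) (hxs : ‖xs‖ ≤ K) (hls : ‖ls‖ ≤ K) :
    |f a - f xs| ≤ 2 * K ^ 2 * ε := by
  have hK : 0 ≤ K := (norm_nonneg _).trans ha
  have h1 := hf.add_inner_gradient_le hd xs a
  have h2 := hf.add_inner_gradient_le hd a xs
  have g1 : gradient f xs = - A.adjoint ls := by
    have := hs.1
    rw [zero_smul, add_zero] at this
    exact eq_neg_of_add_eq_zero_left this
  have g2 : gradient f a = - A.adjoint l - ε • a := by
    rw [← sub_eq_zero, ← h.1]; abel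
  have hAxs : A xs = b := by
    have := hs.2
    rwa [zero_smul, sub_eq_zero] at this
  -- Feasibility of xs and the dual condition at a make both gradient inequalities proportional to
  -- ε.
  have e1 : A (a - xs) = ε • l := by rw [map_sub, hAxs, h.2]
  have e2 : A (xs - a) = -(ε • l) := by rw [← e1, ← map_neg, neg_sub]
  rw [g1, inner_neg_left, ContinuousLinearMap.adjoint_inner_left, e1, inner_smul_right] at h1
  rw [g2, inner_sub_left, inner_neg_left, ContinuousLinearMap.adjoint_inner_left, e2,
    inner_neg_right, inner_smul_right, real_inner_smul_left, inner_sub_right,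
    real_inner_self_eq_norm_sq, real_inner_self_eq_norm_sq] at h2
  have b1 : inner ℝ ls l ≤ K * K := (real_inner_le_norm _ _).trans (by gcongr)
  have b2 : inner ℝ a xs ≤ K * K := (real_inner_le_norm _ _).trans (by gcongr)
  have c1 := mul_le_mul_of_nonneg_left b1 hε
  have c2 := mul_le_mul_of_nonneg_left b2 hε
  have c3 : 0 ≤ ε * ‖l‖ ^ 2 := by positivity
  have c4 : 0 ≤ ε * ‖a‖ ^ 2 := by positivity
  have c5 : 0 ≤ ε * K ^ 2 := by positivity
  rw [abs_le]
  constructor <;> linarith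

omit [InnerProductSpace ℝ X] [CompleteSpace X] [InnerProductSpace ℝ Y] [CompleteSpace Y] in
theorem tendsto_sub_of_sq_norm_le {M σ q k : ℝ} (hσq : σ < q)
    (hm0 : ∀ᶠ t in atTop, 0 < m t) (hmk : ∀ᶠ t in atTop, m t ≤ k / t ^ q)
    (hM : ∀ᶠ t in atTop, ‖x t - xt t‖ ^ 2 + ‖lam t - lt t‖ ^ 2 ≤ M * (m t * t ^ σ)) :
    Tendsto (fun t => WithLp.toLp 2 (x t, lam t) - WithLp.toLp 2 (xt t, lt t)) atTop (𝓝 0) := by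
  have h0 : Tendsto (fun t : ℝ => |M| * (k * t ^ (-(q - σ)))) atTop (𝓝 (|M| * (k * 0))) :=
    ((tendsto_rpow_neg_atTop (by linarith)).const_mul k).const_mul |M|
  rw [mul_zero, mul_zero] at h0
  have h1 : Tendsto (fun t => ‖WithLp.toLp 2 (x t, lam t) - WithLp.toLp 2 (xt t, lt t)‖ ^ 2)
      atTop (𝓝 0) := by
    refine squeeze_zero' (Eventually.of_forall fun t => sq_nonneg _) ?_ h0
    filter_upwards [hM, hm0, hmk, eventually_gt_atTop 0] with t hMt hmt hmkt ht
    have hσ := Real.rpow_pos_of_pos ht σ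
    have hsq : ‖WithLp.toLp 2 (x t, lam t) - WithLp.toLp 2 (xt t, lt t)‖ ^ 2
        = ‖x t - xt t‖ ^ 2 + ‖lam t - lt t‖ ^ 2 := by
      rw [WithLp.prod_norm_sq_eq_of_L2]; simp
    rw [hsq]
    refine hMt.trans ?_
    calc M * (m t * t ^ σ) ≤ |M| * (m t * t ^ σ) := by gcongr; exact le_abs_self M
      _ ≤ |M| * (k / t ^ q * t ^ σ) := by gcongr
      _ = |M| * (k * t ^ (-(q - σ))) := by
        rw [show -(q - σ) = σ - q by ring, Real.rpow_sub ht]; ring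
  rw [tendsto_zero_iff_norm_tendsto_zero]
  have h2 := h1.sqrt
  simpa [Real.sqrt_sq (norm_nonneg _)] using h2

/-- Each quantity is split at the path. The distance to the path contributes √(m t^σ), since ∇f
stays bounded along two curves converging to xs; the path contributes O(c / t^p), by
`IsCritical.abs_sub_le` for f and by A x_t - b = (c / t^p) λ_t for the constraint. The Lagrangian
gap combines the two estimates. -/
theorem rates_of_sq_norm_le (hf : ConvexOn ℝ univ f) (hf1 : ContDiff ℝ 1 f) {M σ t₀ : ℝ}
    (hc : 0 < c) (hm0 : ∀ᶠ t in atTop, 0 < m t)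
    (hM : ∀ᶠ t in atTop, ‖x t - xt t‖ ^ 2 + ‖lam t - lt t‖ ^ 2 ≤ M * (m t * t ^ σ))
    (hx : Tendsto x atTop (𝓝 xs)) (hxt : Tendsto xt atTop (𝓝 xs))
    (hcrit : ∀ t ≥ t₀, IsCritical f A b (c / t ^ p) (xt t) (lt t))
    (hs : IsCritical f A b 0 xs ls)
    (hK : ∀ t ≥ t₀, ‖WithLp.toLp 2 (xt t, lt t)‖ ≤ ‖WithLp.toLp 2 (xs, ls)‖) :
    (fun t => lagrangian f A b (x t) ls - lagrangian f A b xs ls) =O[atTop]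
      (fun t => √(m t) * t ^ (σ / 2) + 1 / t ^ p) ∧
    (fun t => |f (x t) - f xs|) =O[atTop] (fun t => √(m t) * t ^ (σ / 2) + 1 / t ^ p) ∧
    (fun t => ‖A (x t) - b‖) =O[atTop] (fun t => √(m t) * t ^ (σ / 2) + 1 / t ^ p) ∧
    (fun t => ‖WithLp.toLp 2 (x t - xt t, lam t - lt t)‖ ^ 2) =O[atTop]
      (fun t => m t * t ^ σ) := by
  have hd : Differentiable ℝ f := hf1.differentiable one_ne_zero
  set K := ‖WithLp.toLp 2 (xs, ls)‖ with hKdef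
  have hK0 : 0 ≤ K := norm_nonneg _
  have hxsK : ‖xs‖ ≤ K := WithLp.norm_fst_le (p := 2) X (WithLp.toLp 2 (xs, ls))
  have hlsK : ‖ls‖ ≤ K := WithLp.norm_snd_le (p := 2) X (WithLp.toLp 2 (xs, ls))
  have hAxs : A xs = b := by
    have := hs.2
    rwa [zero_smul, sub_eq_zero] at this
  set N := √|M| with hN
  have hN0 : 0 ≤ N := Real.sqrt_nonneg _
  have hU : ∀ᶠ t in atTop, ‖x t - xt t‖ ≤ N * (√(m t) * t ^ (σ / 2)) := by
    filter_upwards [hM, hm0, eventually_gt_atTop 0] with t hMt hmt ht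
    have hσ := Real.rpow_pos_of_pos ht σ
    have e : N * (√(m t) * t ^ (σ / 2)) = √(|M| * (m t * t ^ σ)) := by
      rw [Real.sqrt_mul (abs_nonneg M), Real.sqrt_mul hmt.le, Real.sqrt_eq_rpow (t ^ σ),
        ← Real.rpow_mul ht.le, mul_one_div]
    rw [e]
    refine Real.le_sqrt_of_sq_le ?_
    have h1 : M * (m t * t ^ σ) ≤ |M| * (m t * t ^ σ) := by gcongr; exact le_abs_self M
    linarith [sq_nonneg ‖lam t - lt t‖]
  set L := ‖gradient f xs‖ + 1 with hL
  have hL0 : 0 ≤ L := by positivity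
  have hgrad : ∀ {y : ℝ → X}, Tendsto y atTop (𝓝 xs) → ∀ᶠ t in atTop, ‖gradient f (y t)‖ ≤ L := by
    intro y hy
    have h1 : Tendsto (fun t => ‖gradient f (y t)‖) atTop (𝓝 ‖gradient f xs‖) :=
      ((hf1.continuous_gradient.tendsto xs).comp hy).norm
    exact (h1.eventually (gt_mem_nhds (lt_add_one _))).mono fun _ h => h.le
  have hfbound : ∀ᶠ t in atTop, |f (x t) - f xs|
      ≤ L * N * (√(m t) * t ^ (σ / 2)) + 2 * K ^ 2 * c * (1 / t ^ p) := by
    filter_upwards [hU, hgrad hx, hgrad hxt, eventually_ge_atTop t₀, eventually_gt_atTop 0]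
      with t hUt hg1 hg2 ht ht0
    have hε : 0 ≤ c / t ^ p := div_nonneg hc.le (Real.rpow_nonneg ht0.le p)
    have h1 := (hcrit t ht).abs_sub_le hf hd hε hs
      ((WithLp.norm_fst_le (p := 2) X (WithLp.toLp 2 (xt t, lt t))).trans (hK t ht))
      ((WithLp.norm_snd_le (p := 2) X (WithLp.toLp 2 (xt t, lt t))).trans (hK t ht)) hxsK hlsK
    have h2 : |f (x t) - f (xt t)| ≤ L * ‖x t - xt t‖ := by
      have i1 := hf.add_inner_gradient_le hd (x t) (xt t)
      have i2 := hf.add_inner_gradient_le hd (xt t) (x t)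
      have j1 : -(L * ‖x t - xt t‖) ≤ inner ℝ (gradient f (x t)) (xt t - x t) := by
        have k1 := neg_le_of_abs_le (abs_real_inner_le_norm (gradient f (x t)) (xt t - x t))
        rw [norm_sub_rev] at k1
        have k2 : ‖gradient f (x t)‖ * ‖x t - xt t‖ ≤ L * ‖x t - xt t‖ := by gcongr
        linarith
      have j2 : -(L * ‖x t - xt t‖) ≤ inner ℝ (gradient f (xt t)) (x t - xt t) := by
        have k1 := neg_le_of_abs_le (abs_real_inner_le_norm (gradient f (xt t)) (x t - xt t))
        have k2 : ‖gradient f (xt t)‖ * ‖x t - xt t‖ ≤ L * ‖x t - xt t‖ := by gcongr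
        linarith
      rw [abs_le]
      constructor <;> linarith
    have h3 : |f (x t) - f xs| ≤ |f (x t) - f (xt t)| + |f (xt t) - f xs| := abs_sub_le _ _ _
    have h4 : L * ‖x t - xt t‖ ≤ L * (N * (√(m t) * t ^ (σ / 2))) := by gcongr
    have h5 : 2 * K ^ 2 * (c / t ^ p) = 2 * K ^ 2 * c * (1 / t ^ p) := by ring
    linarith
  have hAbound : ∀ᶠ t in atTop, ‖A (x t) - b‖
      ≤ ‖A‖ * N * (√(m t) * t ^ (σ / 2)) + K * c * (1 / t ^ p) := by
    filter_upwards [hU, eventually_ge_atTop t₀, eventually_gt_atTop 0] with t hUt ht ht0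
    have hε : 0 ≤ c / t ^ p := div_nonneg hc.le (Real.rpow_nonneg ht0.le p)
    have hlK := (WithLp.norm_snd_le (p := 2) X (WithLp.toLp 2 (xt t, lt t))).trans (hK t ht)
    have e : A (x t) - b = A (x t - xt t) + (c / t ^ p) • lt t := by
      rw [← (hcrit t ht).2, map_sub]; abel
    rw [e]
    calc ‖A (x t - xt t) + (c / t ^ p) • lt t‖
        ≤ ‖A (x t - xt t)‖ + ‖(c / t ^ p) • lt t‖ := norm_add_le _ _
      _ ≤ ‖A‖ * ‖x t - xt t‖ + c / t ^ p * ‖lt t‖ := by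
          rw [norm_smul, Real.norm_of_nonneg hε]
          gcongr
          exact A.le_opNorm _
      _ ≤ ‖A‖ * (N * (√(m t) * t ^ (σ / 2))) + c / t ^ p * K := by
          gcongr
          exact hlK
      _ = _ := by ring
  have hO : ∀ {u : ℝ → ℝ} {a₁ a₂ : ℝ}, 0 ≤ a₁ → 0 ≤ a₂ →
      (∀ᶠ t in atTop, ‖u t‖ ≤ a₁ * (√(m t) * t ^ (σ / 2)) + a₂ * (1 / t ^ p)) →
      u =O[atTop] (fun t => √(m t) * t ^ (σ / 2) + 1 / t ^ p) := by
    intro u a₁ a₂ h₁ h₂ hu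
    refine IsBigO.of_bound (a₁ + a₂) ?_
    filter_upwards [hu, eventually_gt_atTop 0] with t ht ht0
    have r1 : 0 ≤ √(m t) * t ^ (σ / 2) :=
      mul_nonneg (Real.sqrt_nonneg _) (Real.rpow_nonneg ht0.le _)
    have r2 : 0 ≤ 1 / t ^ p := div_nonneg zero_le_one (Real.rpow_nonneg ht0.le p)
    rw [Real.norm_of_nonneg (add_nonneg r1 r2)]
    have r3 := mul_nonneg h₁ r2
    have r4 := mul_nonneg h₂ r1
    linarith
  refine ⟨?_, ?_, ?_, ?_⟩
  · refine hO (a₁ := L * N + K * (‖A‖ * N)) (a₂ := 2 * K ^ 2 * c + K * (K * c)) (by positivity)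
      (by positivity) ?_
    filter_upwards [hfbound, hAbound] with t h1 h2
    have e : lagrangian f A b (x t) ls - lagrangian f A b xs ls
        = (f (x t) - f xs) + inner ℝ ls (A (x t) - b) := by
      unfold lagrangian
      rw [hAxs, sub_self, inner_zero_right]
      ring
    have h3 : |inner ℝ ls (A (x t) - b)| ≤ K * ‖A (x t) - b‖ :=
      (abs_real_inner_le_norm _ _).trans (by gcongr)
    have h4 := mul_le_mul_of_nonneg_left h2 hK0
    have h5 := abs_add_le (f (x t) - f xs) (inner ℝ ls (A (x t) - b))
    rw [e, Real.norm_eq_abs]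
    linarith
  · refine hO (a₁ := L * N) (a₂ := 2 * K ^ 2 * c) (by positivity) (by positivity) ?_
    filter_upwards [hfbound] with t h1
    rwa [Real.norm_eq_abs, abs_abs]
  · refine hO (a₁ := ‖A‖ * N) (a₂ := K * c) (by positivity) (by positivity) ?_
    filter_upwards [hAbound] with t h1
    rwa [norm_norm]
  · refine IsBigO.of_bound |M| ?_
    filter_upwards [hM, hm0, eventually_gt_atTop 0] with t hMt hmt ht
    have hσ := Real.rpow_pos_of_pos ht σ
    rw [WithLp.prod_norm_sq_eq_of_L2, Real.norm_of_nonneg (by positivity),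
      Real.norm_of_nonneg (by positivity)]
    refine hMt.trans ?_
    gcongr
    exact le_abs_self M

end Conclusion

end

/-! ### The main theorem: choice of exponents -/

theorem mainTheorem3 {X Y : Type*}
    [NormedAddCommGroup X] [InnerProductSpace ℝ X] [CompleteSpace X]
    [NormedAddCommGroup Y] [InnerProductSpace ℝ Y] [CompleteSpace Y]
    (f : X → ℝ) (hf_smooth : ContDiff ℝ 1 f) (hf_convex : ConvexOn ℝ univ f)
    (A : X →L[ℝ] Y) (b : Y)
    (c p α γ q s t₀ : ℝ) (hc : 0 < c) (hα : 1 < α) (hγ : 0 < γ)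
    (hq0 : 0 < q) (hq1 : q < 1) (hs : 0 < s) (ht₀ : 0 < t₀)
    (m : ℝ → ℝ) (hm : IsMass t₀ m)
    (hm1 : MassBounds γ q s m) (hm2 : MassDerivBounds t₀ m)
    (hp0 : 0 < p) (hp1 : p < (1 - q) / 2)
    (hqs : 5 * q + 2 * s - 1 < 0) (hqsp : 4 * q + s + p - 2 < 0)
    (x : ℝ → X) (lam : ℝ → Y)
    (hsol : IsGlobalSolution f A b c p α γ q s t₀ m x lam)
    (xs : X) (ls : Y)
    (hproj : IsProjOnto (saddleSet f A b) 0 (WithLp.toLp 2 (xs, ls))) :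
    -- the saddle point of `𝓛_t` exists and is unique
    (∀ t ≥ t₀, ∃! z : X × Y,
      IsSaddlePointOn univ univ (augLagrangian f A b c p t) z.1 z.2) ∧
    ∀ (xt : ℝ → X) (lt : ℝ → Y),
      (∀ t ≥ t₀, IsSaddlePointOn univ univ (augLagrangian f A b c p t) (xt t) (lt t)) →
      -- (i) strong convergence
      Tendsto (fun t => ‖WithLp.toLp 2 (x t, lam t) - WithLp.toLp 2 (xs, ls)‖) atTop (𝓝 0) ∧
      -- (ii)
      (p < 2 * q + s →
        (fun t => lagrangian f A b (x t) ls - lagrangian f A b xs ls) =O[atTop]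
          (fun t => √(m t) * t ^ ((3 * q + s - p - 1) / 2) + 1 / t ^ p) ∧
        (fun t => |f (x t) - f xs|) =O[atTop]
          (fun t => √(m t) * t ^ ((3 * q + s - p - 1) / 2) + 1 / t ^ p) ∧
        (fun t => ‖A (x t) - b‖) =O[atTop]
          (fun t => √(m t) * t ^ ((3 * q + s - p - 1) / 2) + 1 / t ^ p) ∧
        (fun t => ‖WithLp.toLp 2 (x t - xt t, lam t - lt t)‖ ^ 2) =O[atTop]
          (fun t => m t * t ^ (3 * q + s - p - 1))) ∧
      -- (iii)
      (2 * q + s ≤ p →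
        (fun t => lagrangian f A b (x t) ls - lagrangian f A b xs ls) =O[atTop]
          (fun t => √(m t) * t ^ ((q - 1) / 2) + 1 / t ^ p) ∧
        (fun t => |f (x t) - f xs|) =O[atTop]
          (fun t => √(m t) * t ^ ((q - 1) / 2) + 1 / t ^ p) ∧
        (fun t => ‖A (x t) - b‖) =O[atTop]
          (fun t => √(m t) * t ^ ((q - 1) / 2) + 1 / t ^ p) ∧
        (fun t => ‖WithLp.toLp 2 (x t - xt t, lam t - lt t)‖ ^ 2) =O[atTop]
          (fun t => m t * t ^ (q - 1))) := by
  have hd : Differentiable ℝ f := hf_smooth.differentiable one_ne_zero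
  have hε : ∀ t ≥ t₀, 0 < c / t ^ p := fun t ht =>
    div_pos hc (Real.rpow_pos_of_pos (ht₀.trans_le ht) p)
  have hp2 : p < 1 := by linarith
  refine ⟨fun t ht => ?_, fun xt lt hsaddle => ?_⟩
  · rw [augLagrangian_eq_regLagrangian]
    exact existsUnique_isSaddlePointOn hf_convex hd (hε t ht)
  have hcrit : ∀ t ≥ t₀, IsCritical f A b (c / t ^ p) (xt t) (lt t) := by
    intro t ht
    have h := hsaddle t ht
    rw [augLagrangian_eq_regLagrangian] at h
    exact h.isCritical hd
  have hzero : ∀ z : WithLp 2 (X × Y), z ∈ saddleSet f A b ↔ saddleOperator f A b z = 0 := by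
    intro z
    rw [saddleOperator_eq_zero_iff, ← isSaddlePointOn_regLagrangian_iff hf_convex hd le_rfl,
      ← lagrangian_eq_regLagrangian]
    rfl
  have hs0 := (hzero _).1 hproj.1
  have hxl : IsCritical f A b 0 xs ls := saddleOperator_eq_zero_iff.1 hs0
  have hmono := isMonotoneOperator_saddleOperator (A := A) (b := b) hf_convex hd
  have hz : ∀ t ≥ t₀, saddleOperator f A b (WithLp.toLp 2 (xt t, lt t))
      + (c / t ^ p) • WithLp.toLp 2 (xt t, lt t) = 0 := fun t ht =>
    saddleOperator_add_smul_eq_zero_iff.2 (hcrit t ht)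
  have hK : ∀ t ≥ t₀, ‖WithLp.toLp 2 (xt t, lt t)‖ ≤ ‖WithLp.toLp 2 (xs, ls)‖ := fun t ht =>
    hmono.norm_le (hε t ht) (hz t ht) hs0
  have hpath : Tendsto (fun t => WithLp.toLp 2 (xt t, lt t)) atTop (𝓝 (WithLp.toLp 2 (xs, ls))) := by
    refine hmono.tendsto_path (continuous_saddleOperator hf_smooth) hs0 (fun v hv => ?_) hε ?_ ?_ hz
    · simpa using hproj.2 v ((hzero v).2 hv)
    · intro u hu v hv huv
      have hu0 : 0 < u := ht₀.trans_le hu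
      have := Real.rpow_pos_of_pos hu0 p
      simp only
      gcongr
    · exact (tendsto_rpow_atTop hp0).const_div_atTop c
  have hm0 : ∀ᶠ t in atTop, 0 < m t := (eventually_ge_atTop t₀).mono fun t ht => hm.pos t ht
  obtain ⟨k₁, -, hmb⟩ := id hm1
  have hrate : ∀ {r σ : ℝ}, 0 ≤ r → r < 1 → p - q - s ≤ r → 2 * q + s + p - 2 ≤ σ - r →
      q - 2 ≤ σ - r → ∃ M, ∀ᶠ t in atTop,
        ‖x t - xt t‖ ^ 2 + ‖lam t - lt t‖ ^ 2 ≤ M * (m t * t ^ σ) := fun h0 h1 h2 h3 h4 =>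
    exists_sq_norm_le hf_convex hd hc hα hγ hq0 hq1 hs ht₀ hm hm1 hm2 hp0 hp2 hsol h0 h1 h2 h3 h4
      hcrit hK
  have hlim : ∀ {M σ : ℝ}, σ < q → (∀ᶠ t in atTop,
      ‖x t - xt t‖ ^ 2 + ‖lam t - lt t‖ ^ 2 ≤ M * (m t * t ^ σ)) →
      Tendsto (fun t => WithLp.toLp 2 (x t, lam t)) atTop (𝓝 (WithLp.toLp 2 (xs, ls))) := by
    intro M σ hσ hM
    have h := (tendsto_sub_of_sq_norm_le hσ hm0 (hmb.mono fun t h => h.2) hM).add hpath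
    simpa using h
  have hfst : ∀ {y : ℝ → X} {l : ℝ → Y},
      Tendsto (fun t => WithLp.toLp 2 (y t, l t)) atTop (𝓝 (WithLp.toLp 2 (xs, ls))) →
      Tendsto y atTop (𝓝 xs) := fun h => ((WithLp.continuous_fst 2 X Y).tendsto _).comp h
  -- Take r = max(0, p - q - s). When r > 0, the remainder condition is 3p ≤ 2q + s + 1, the sum of
  -- p < 2q + s and 2p < 1 - q.
  have hsmall : p < 2 * q + s → ∃ M, ∀ᶠ t in atTop,
      ‖x t - xt t‖ ^ 2 + ‖lam t - lt t‖ ^ 2 ≤ M * (m t * t ^ (3 * q + s - p - 1)) := by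
    intro hp
    rcases le_total (p - q - s) 0 with h | h
    · exact hrate (r := 0) le_rfl one_pos h (by linarith) (by linarith)
    · exact hrate (r := p - q - s) h (by linarith) le_rfl (by linarith) (by linarith)
  -- With r = p - q - s and σ = q - 1 the remainder condition reduces to 2p ≤ 1.
  have hlarge : 2 * q + s ≤ p → ∃ M, ∀ᶠ t in atTop,
      ‖x t - xt t‖ ^ 2 + ‖lam t - lt t‖ ^ 2 ≤ M * (m t * t ^ (q - 1)) := fun hp =>
    hrate (r := p - q - s) (by linarith) (by linarith) le_rfl (by linarith) (by linarith)
  have hconv : Tendsto (fun t => WithLp.toLp 2 (x t, lam t)) atTop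
      (𝓝 (WithLp.toLp 2 (xs, ls))) := by
    -- As m = O(t^(-q)), convergence needs σ < q. In the first case this reads 2q + s - p < 1, a
    -- consequence of 5q + 2s < 1; in the second it is immediate.
    rcases lt_or_ge p (2 * q + s) with hp | hp
    · obtain ⟨M, hM⟩ := hsmall hp
      exact hlim (by linarith) hM
    · obtain ⟨M, hM⟩ := hlarge hp
      exact hlim (by linarith) hM
  refine ⟨tendsto_iff_norm_sub_tendsto_zero.1 hconv, fun hp => ?_, fun hp => ?_⟩
  · obtain ⟨M, hM⟩ := hsmall hp
    exact rates_of_sq_norm_le hf_convex hf_smooth hc hm0 hM (hfst hconv) (hfst hpath) hcrit hxl hK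
  · obtain ⟨M, hM⟩ := hlarge hp
    exact rates_of_sq_norm_le hf_convex hf_smooth hc hm0 hM (hfst hconv) (hfst hpath) hcrit hxl hK
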